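/- Let $J=\begin{pmatrix}0&1\\-1&0\end{pmatrix}$, let $\mu^-<\mu^+$ be real numbers, put $P_\infty=\operatorname{diag}(\mu^-,\mu^+)$, and let $P$ be a continuous map from $(0,+\infty)$ to the real symmetric $2\times 2$ matrices such that: * $P(x)\to P_\infty$ as $x\to+\infty$ and $\int_1^{+\infty}\|P(x)-P_\infty\|^{q_\infty}\,dx<+\infty$ for some real $q_\infty\ge 1$; * there are a real $\beta\ge 1$, a real symmetric $2\times2$ matrix $P^*$ and a real $q_0\ge 1$ with $x^\beta P(x)\to P^*$ as $x\to 0^+$ and $\int_0^1 x^{-\beta}\|x^\beta P(x)-P^*\|^{q_0}\,dx<+\infty$, where $\det P^*<-1/4$ if $\beta=1$ and $\det P^*<0$ if $\beta>1$. Let $L^2=L^2((0,+\infty),\mathbb R^2)$, $\tau z=Jz'+Pz$, and let $D_0$ be the space of all $z\in L^2$ that are locally absolutely continuous on $(0,+\infty)$ and satisfy $\tau z\in L^2$, with the graph norm $\|z\|_0^2=\|z\|_{L^2}^2+\|\tau z\|_{L^2}^2$. Let $S$ be a continuous map from $(0,+\infty)\times\mathbb R^2$ to the real symmetric $2\times 2$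 matrices, with entries $S_{ij}$, such that: * (S1) there are $\alpha\in L^\infty(0,+\infty)$ and $\eta_{ij}\in C(\mathbb R^2)$ with $\eta_{ij}(0)=0$ and $|S_{ij}(x,z)|\le\alpha(x)\,\eta_{ij}(z)$ for all $x>0$, $z\in\mathbb R^2$ and $i,j\in\{1,2\}$; * (S2) for every compact $K\subset\mathbb R^2$ there is $A_K>0$ with $\|S(x,z)-S(x,z')\|\le A_K\|z-z'\|$ for all $x>0$ and $z,z'\in K$. Assume moreover that the function $\alpha$ in (S1) satisfies $\lim_{x\to+\infty}\alpha(x)=0$. Then for every $z\in D_0$ the function $M(z)(x)=S(x,z(x))z(x)$, $x>0$, belongs to $L^2$; the map $M:(D_0,\|\cdot\|_0)\to L^2$ is continuous and compact, i.e. it maps bounded sets to relatively compact sets; and $\|M(z)\|_{L^2}=o(\|z\|_0)$ as $z\to 0$ in $(D_0,\|\cdot\|_0)$. -/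

import Mathlib

open MeasureTheory Set Filter Topology
open scoped Matrix.Norms.L2Operator

noncomputable section

namespace DiracHalfLine

/-- The Euclidean plane `ℝ²`. -/
abbrev Plane : Type := EuclideanSpace ℝ (Fin 2)

/-- Real `2 × 2` matrices, normed by the operator norm of the Euclidean plane. -/
abbrev Mat : Type := Matrix (Fin 2) (Fin 2) ℝ

/-- Lebesgue measure on the open half-line `(0, +∞)`. -/
abbrev halfLine : Measure ℝ := volume.restrict (Ioi 0)

/-- The Hilbert space `L²((0, +∞), ℝ²)`. -/
abbrev L2 : Type := Lp Plane 2 halfLine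

/-- The matrix `J` with rows `(0, 1)` and `(-1, 0)`. -/
def J : Mat := !![0, 1; -1, 0]

/-- Application of a matrix to a vector of the Euclidean plane. -/
def app (A : Mat) (v : Plane) : Plane := Matrix.toEuclideanLin A v

/-! ### The class of linear potentials -/

/-- The limit at infinity of the potential, with diagonal entries `μm < μp`. -/
def limitAtTop (μm μp : ℝ) : Mat := !![μm, 0; 0, μp]

/-- Behaviour at infinity: convergence to the diagonal matrix, the remainder being a `q`-th power
integrable function on `(1, +∞)` for some real `q ≥ 1`. -/
def ConditionP1 (μm μp : ℝ) (P : ℝ → Mat) : Prop :=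
  Tendsto P atTop (𝓝 (limitAtTop μm μp)) ∧
    ∃ q : ℝ, 1 ≤ q ∧ IntegrableOn (fun x => ‖P x - limitAtTop μm μp‖ ^ q) (Ioi 1)

/-- Behaviour at zero, with exponent `β` and symmetric limit matrix `Pz`. -/
def ConditionP2 (β : ℝ) (Pz : Mat) (P : ℝ → Mat) : Prop :=
  1 ≤ β ∧ Pz.IsSymm ∧
    Tendsto (fun x : ℝ => (x ^ β) • P x) (𝓝[>] 0) (𝓝 Pz) ∧
    ∃ q : ℝ, 1 ≤ q ∧
      IntegrableOn (fun x : ℝ => 1 / x ^ β * ‖(x ^ β) • P x - Pz‖ ^ q) (Ioo 0 1)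

/-- The determinant condition on the limit matrix at zero. -/
def ConditionP3 (β : ℝ) (Pz : Mat) : Prop :=
  (β = 1 → Pz.det < -1 / 4) ∧ (1 < β → Pz.det < 0)

/-- The class of potentials: continuous maps from `(0, +∞)` to symmetric matrices that satisfy the
three conditions above (values at `x ≤ 0` play no role). -/
structure IsPotential (μm μp : ℝ) (P : ℝ → Mat) : Prop where
  continuousOn : ContinuousOn P (Ioi 0)
  symm : ∀ x > 0, (P x).IsSymm
  atTop : ConditionP1 μm μp P
  atZero : ∃ (β : ℝ) (Pz : Mat), ConditionP2 β Pz P ∧ ConditionP3 β Pz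

/-! ### The operator `τ` and its domain -/

/-- Local absolute continuity on `(0, +∞)`. -/
def LocAC (z : ℝ → Plane) : Prop :=
  ∀ a b : ℝ, 0 < a → 0 < b → AbsolutelyContinuousOnInterval z a b

/-- The differential expression `τ z = J z' + P z`. -/
def tau (P : ℝ → Mat) (z : ℝ → Plane) (x : ℝ) : Plane :=
  app J (deriv z x) + app (P x) (z x)

theorem LocAC.add {z w : ℝ → Plane} (hz : LocAC z) (hw : LocAC w) : LocAC (z + w) :=
  fun a b ha hb => (hz a b ha hb).add (hw a b ha hb)

theorem LocAC.smul {z : ℝ → Plane} (c : ℝ) (hz : LocAC z) : LocAC (fun x => c • z x) :=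
  fun a b ha hb => (hz a b ha hb).const_smul c

theorem LocAC.continuousOn {z : ℝ → Plane} (hz : LocAC z) : ContinuousOn z (Ioi 0) := by
  intro x hx
  have hx' : (0 : ℝ) < x := hx
  have h := (hz (x / 2) (x + 1) (by positivity) (by positivity)).continuousOn
  refine (h.continuousAt ?_).continuousWithinAt
  rw [uIcc_of_le (by linarith)]
  exact Icc_mem_nhds (by linarith) (by linarith)

theorem LocAC.ae_differentiableAt {z : ℝ → Plane} (hz : LocAC z) :
    ∀ᵐ x ∂halfLine, DifferentiableAt ℝ z x := by
  rw [ae_restrict_iff' measurableSet_Ioi]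
  have h : ∀ n : ℕ, ∀ᵐ x : ℝ, x ∈ uIcc (1 / ((n : ℝ) + 1)) ((n : ℝ) + 1) →
      DifferentiableAt ℝ z x := fun n =>
    (hz _ _ (by positivity) (by positivity)).boundedVariationOn.ae_differentiableAt_of_mem_uIcc
  filter_upwards [ae_all_iff.2 h] with x hx hx0
  have hx0' : (0 : ℝ) < x := hx0
  obtain ⟨n, hn⟩ := exists_nat_gt (max x (1 / x))
  have h1 : x < n := (le_max_left _ _).trans_lt hn
  have h2 : 1 / x < n := (le_max_right _ _).trans_lt hn
  refine hx n (mem_uIcc_of_le ?_ (by linarith))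
  rw [div_le_iff₀ (by positivity)]
  rw [div_lt_iff₀ hx0'] at h2
  nlinarith

theorem tau_add (P : ℝ → Mat) {z w : ℝ → Plane} (hz : LocAC z) (hw : LocAC w) :
    tau P (z + w) =ᵐ[halfLine] tau P z + tau P w := by
  filter_upwards [hz.ae_differentiableAt, hw.ae_differentiableAt] with x h1 h2
  simp only [tau, app, Pi.add_apply, deriv_add h1 h2, map_add]
  abel

theorem tau_smul (P : ℝ → Mat) (c : ℝ) {z : ℝ → Plane} (hz : LocAC z) :
    tau P (fun x => c • z x) =ᵐ[halfLine] c • tau P z := by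
  filter_upwards [hz.ae_differentiableAt] with x h1
  simp only [tau, app, Pi.smul_apply, deriv_fun_const_smul c h1, map_smul, smul_add]

/-- Two locally absolutely continuous functions that agree almost everywhere have the same `τ`. -/
theorem tau_congr (P : ℝ → Mat) {z w : ℝ → Plane} (hz : LocAC z) (hw : LocAC w)
    (h : z =ᵐ[halfLine] w) : tau P z =ᵐ[halfLine] tau P w := by
  have hEq : EqOn z w (Ioi 0) :=
    Measure.eqOn_open_of_ae_eq h isOpen_Ioi hz.continuousOn hw.continuousOn
  refine (ae_restrict_iff' measurableSet_Ioi).2 (Eventually.of_forall fun x hx => ?_)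
  have hd : z =ᶠ[𝓝 x] w := hEq.eventuallyEq_of_mem (isOpen_Ioi.mem_nhds hx)
  simp only [tau, hd.deriv_eq, hEq hx]

/-- The domain `D₀` of the operator, as a linear subspace of `L²`: the square integrable functions
`z` on `(0, +∞)` that are locally absolutely continuous (have such a representative) and for which
`τ z` is square integrable. -/
def D0 (P : ℝ → Mat) : Submodule ℝ L2 where
  carrier := {f | ∃ z : ℝ → Plane, f =ᵐ[halfLine] z ∧ LocAC z ∧ MemLp (tau P z) 2 halfLine}
  zero_mem' := by
    refine ⟨fun _ => 0, Lp.coeFn_zero _ _ _, fun a b _ _ => ?_, ?_⟩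
    · exact (contDiff_const.contDiffOn (n := 1)).absolutelyContinuousOnInterval
    · have : tau P (fun _ => 0) = fun _ => 0 := by
        funext x
        simp [tau, app]
      rw [this]
      exact MemLp.zero'
  add_mem' := by
    rintro f g ⟨z, hfz, hz, hzL⟩ ⟨w, hgw, hw, hwL⟩
    exact ⟨z + w, (Lp.coeFn_add f g).trans (hfz.add hgw), hz.add hw,
      (memLp_congr_ae (tau_add P hz hw)).2 (hzL.add hwL)⟩
  smul_mem' := by
    rintro c f ⟨z, hfz, hz, hzL⟩
    exact ⟨fun x => c • z x, (Lp.coeFn_smul c f).trans (hfz.const_smul c), hz.smul c,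
      (memLp_congr_ae (tau_smul P c hz)).2 (hzL.const_smul c)⟩

/-- The locally absolutely continuous representative of an element of `D₀`. -/
def rep {P : ℝ → Mat} (f : D0 P) : ℝ → Plane := f.2.choose

theorem coe_ae_eq_rep {P : ℝ → Mat} (f : D0 P) : (f : L2) =ᵐ[halfLine] rep f :=
  f.2.choose_spec.1

theorem locAC_rep {P : ℝ → Mat} (f : D0 P) : LocAC (rep f) := f.2.choose_spec.2.1

theorem memLp_tau_rep {P : ℝ → Mat} (f : D0 P) : MemLp (tau P (rep f)) 2 halfLine :=
  f.2.choose_spec.2.2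

/-- The operator `A₀ : D₀ → L²`, `A₀ z = τ z`. -/
def A0 (P : ℝ → Mat) : D0 P →ₗ[ℝ] L2 where
  toFun f := (memLp_tau_rep f).toLp _
  map_add' f g := by
    rw [← MemLp.toLp_add, MemLp.toLp_eq_toLp_iff]
    refine (tau_congr P (locAC_rep _) ((locAC_rep f).add (locAC_rep g)) ?_).trans
      (tau_add P (locAC_rep f) (locAC_rep g))
    exact (coe_ae_eq_rep (f + g)).symm.trans ((Lp.coeFn_add (f : L2) (g : L2)).trans
      ((coe_ae_eq_rep f).add (coe_ae_eq_rep g)))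
  map_smul' c f := by
    rw [RingHom.id_apply, ← MemLp.toLp_const_smul, MemLp.toLp_eq_toLp_iff]
    refine (tau_congr P (locAC_rep _) ((locAC_rep f).smul c) ?_).trans
      (tau_smul P c (locAC_rep f))
    exact (coe_ae_eq_rep (c • f)).symm.trans ((Lp.coeFn_smul c (f : L2)).trans
      ((coe_ae_eq_rep f).const_smul c))

/-- `A₀ f = τ z` for every locally absolutely continuous representative `z` of `f`. -/
theorem A0_ae_eq {P : ℝ → Mat} (f : D0 P) {z : ℝ → Plane} (hfz : (f : L2) =ᵐ[halfLine] z)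
    (hz : LocAC z) : A0 P f =ᵐ[halfLine] tau P z :=
  (MemLp.coeFn_toLp (memLp_tau_rep f)).trans
    (tau_congr P (locAC_rep f) hz ((coe_ae_eq_rep f).symm.trans hfz))

/-! ### The graph norm -/

/-- The space `D₀` carrying the graph norm of `A₀` (a copy of the subspace `D0 P`, which itself
carries the norm of `L²`). -/
def D0Graph (P : ℝ → Mat) : Type := ↥(D0 P)

instance (P : ℝ → Mat) : AddCommGroup (D0Graph P) := inferInstanceAs (AddCommGroup ↥(D0 P))

instance (P : ℝ → Mat) : Module ℝ (D0Graph P) := inferInstanceAs (Module ℝ ↥(D0 P))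

/-- The element of `L²` underlying an element of `D₀`. -/
def D0Graph.toL2 {P : ℝ → Mat} : D0Graph P →ₗ[ℝ] L2 := (D0 P).subtype

/-- The operator `A₀` on the space `D₀` with the graph norm. -/
def D0Graph.apply {P : ℝ → Mat} : D0Graph P →ₗ[ℝ] L2 := A0 P

/-- The map `z ↦ (z, A₀ z)` into the Hilbert sum of two copies of `L²`. -/
def D0Graph.toGraph (P : ℝ → Mat) : D0Graph P →ₗ[ℝ] WithLp 2 (L2 × L2) :=
  (WithLp.linearEquiv 2 ℝ (L2 × L2)).symm.toLinearMap.comp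
    (LinearMap.prod D0Graph.toL2 D0Graph.apply)

theorem D0Graph.toGraph_injective (P : ℝ → Mat) : Function.Injective (D0Graph.toGraph P) := by
  intro f g h
  have h1 : (f.toL2, f.apply) = (g.toL2, g.apply) :=
    (WithLp.linearEquiv 2 ℝ (L2 × L2)).symm.injective h
  exact Subtype.ext (Prod.ext_iff.1 h1).1

/-- The graph norm on `D₀`. -/
instance (P : ℝ → Mat) : NormedAddCommGroup (D0Graph P) :=
  NormedAddCommGroup.induced _ _ (D0Graph.toGraph P) (D0Graph.toGraph_injective P)

instance (P : ℝ → Mat) : NormedSpace ℝ (D0Graph P) :=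
  NormedSpace.induced ℝ (D0Graph P) (WithLp 2 (L2 × L2)) (D0Graph.toGraph P)

theorem D0Graph.norm_sq {P : ℝ → Mat} (f : D0Graph P) :
    ‖f‖ ^ 2 = ‖f.toL2‖ ^ 2 + ‖f.apply‖ ^ 2 :=
  WithLp.prod_norm_sq_eq_of_L2 (D0Graph.toGraph P f)

/-! ### The nonlinear term -/

/-- The growth condition on `S`, with a bounded measurable weight `α` and continuous functions
`η i j` that vanish at zero. -/
structure ConditionS1 (S : ℝ → Plane → Mat) (α : ℝ → ℝ) (η : Fin 2 → Fin 2 → Plane → ℝ) :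
    Prop where
  memLp : MemLp α ⊤ halfLine
  continuous : ∀ i j, Continuous (η i j)
  zero : ∀ i j, η i j 0 = 0
  bound : ∀ x > 0, ∀ z i j, |S x z i j| ≤ α x * η i j z

/-- Lipschitz continuity in `z` on compact sets, uniformly in `x > 0`. -/
def ConditionS2 (S : ℝ → Plane → Mat) : Prop :=
  ∀ K : Set Plane, IsCompact K →
    ∃ A > 0, ∀ x > 0, ∀ z ∈ K, ∀ w ∈ K, ‖S x z - S x w‖ ≤ A * ‖z - w‖

/-- `M` is the Nemytskii operator `M(z)(x) = S(x, z(x)) z(x)` from `D₀` to `L²`. Such an `M` is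
unique, and exists exactly when the right hand side is in `L²` for every `z` in `D₀`. -/
def IsNemytskii {P : ℝ → Mat} (S : ℝ → Plane → Mat) (M : D0Graph P → L2) : Prop :=
  ∀ z : D0Graph P, M z =ᵐ[halfLine] fun x => app (S x (z.toL2 x)) (z.toL2 x)

end DiracHalfLine

end

open DiracHalfLine

namespace DiracHalfLine

open scoped RealInnerProductSpace

/-! Everything rests on a sup bound `|z(x)| ≤ C ‖z‖_0` on all of (0, ∞) (`exists_sup_bound`). By
(S1), `S(x, 0) = 0`, so (S2) makes `z ↦ S(x, z) z` quadratically small and Lipschitz on balls,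
uniformly in `x`. With the sup bound, `M` is therefore well defined, Lipschitz on bounded sets, and
`O(‖z‖_0²)` at 0.

Away from 0 the sup bound is of Sobolev type. Near 0, with `A = J P*`, the equation is a
perturbation of `z' = x^(-β) A z`, where `A² = l²` and `l² = -det P* > 0`. The form `q_k = |(A + l)
z|² - k |(A - l) z|²` satisfies `q_k' ≥ |q_k| / x - K x |τ z|²` (`lyapunov_le`); for `β = 1` this is
where `l > 1/2` is needed. Integrating up to `δ` bounds `q_k` above. If `q_k` were very negative
somewhere, it would lie below `-m / x` all the way down to 0, contradicting `z ∈ L²`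
(`neg_le_of_singular_deriv`). The upper bound for `k = 1` and the lower bound for `k = 2` together
control `|z|²`.

For compactness (0, ∞) is cut in three. On (0, a] the sup bound and the short length suffice. Beyond
`b` the decay of `α` makes `M(z)` small relative to `|z|`, hence small in L². On [a, b] bounded sets
of `D₀` are totally bounded in the sup norm by Arzelà–Ascoli. `IsNemytskii.exists_local_control`
combines the three. -/

/-! ### Differential inequalities for absolutely continuous functions -/

theorem absolutelyContinuousOnInterval_comp_lipschitz {X Y : Type*} [PseudoMetricSpace X]
    [PseudoMetricSpace Y] {K : NNReal} {g : X → Y} (hg : LipschitzWith K g) {f : ℝ → X} {a b : ℝ}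
    (hf : AbsolutelyContinuousOnInterval f a b) :
    AbsolutelyContinuousOnInterval (fun x => g (f x)) a b := by
  apply squeeze_zero (fun t ↦ ?_) (fun t ↦ ?_) (by simpa using Tendsto.const_mul (K : ℝ) hf)
  · exact Finset.sum_nonneg (fun i hi ↦ by positivity)
  · rw [Finset.mul_sum]
    gcongr
    exact hg.dist_le_mul _ _

theorem LocAC.normSq_comp {z : ℝ → Plane} (hz : LocAC z) (T : Plane →L[ℝ] Plane) {a b : ℝ}
    (ha : 0 < a) (hb : 0 < b) :
    AbsolutelyContinuousOnInterval (fun x => ‖T (z x)‖ ^ 2) a b := by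
  have h := absolutelyContinuousOnInterval_comp_lipschitz lipschitzWith_one_norm
    (absolutelyContinuousOnInterval_comp_lipschitz T.lipschitz (hz a b ha hb))
  simpa only [sq] using h.fun_mul h

/-- A lower bound on the derivative of an absolutely continuous function bounds its increments. -/
theorem integral_le_sub_of_le_deriv {φ ψ : ℝ → ℝ} {a b : ℝ} (hab : a ≤ b)
    (hφ : AbsolutelyContinuousOnInterval φ a b) (hψ : IntervalIntegrable ψ volume a b)
    (h : ∀ᵐ x, x ∈ Ioc a b → ψ x ≤ deriv φ x) : ∫ x in a..b, ψ x ≤ φ b - φ a := by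
  rw [← hφ.integral_deriv_eq_sub, intervalIntegral.integral_of_le hab,
    intervalIntegral.integral_of_le hab]
  exact setIntegral_mono_on_ae hψ.1 hφ.intervalIntegrable_deriv.1 measurableSet_Ioc h

theorem sub_le_integral_of_deriv_le {φ ψ : ℝ → ℝ} {a b : ℝ} (hab : a ≤ b)
    (hφ : AbsolutelyContinuousOnInterval φ a b) (hψ : IntervalIntegrable ψ volume a b)
    (h : ∀ᵐ x, x ∈ Ioc a b → deriv φ x ≤ ψ x) : φ b - φ a ≤ ∫ x in a..b, ψ x := by
  rw [← hφ.integral_deriv_eq_sub, intervalIntegral.integral_of_le hab,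
    intervalIntegral.integral_of_le hab]
  exact setIntegral_mono_on_ae hφ.intervalIntegrable_deriv.1 hψ.1 measurableSet_Ioc h

theorem intervalIntegrable_of_halfLine {F : ℝ → ℝ} (hF : Integrable F halfLine) {a b : ℝ}
    (ha : 0 < a) (hab : a ≤ b) : IntervalIntegrable F volume a b := by
  rw [intervalIntegrable_iff_integrableOn_Ioc_of_le hab]
  exact IntegrableOn.mono_set hF fun x hx => ha.trans hx.1

theorem intervalIntegral_le_halfLine {F : ℝ → ℝ} (hF : Integrable F halfLine)
    (hF0 : ∀ x, 0 ≤ F x) {a b : ℝ} (ha : 0 < a) (hab : a ≤ b) :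
    ∫ x in a..b, F x ≤ ∫ x, F x ∂halfLine := by
  rw [intervalIntegral.integral_of_le hab]
  exact setIntegral_mono_set hF (ae_of_all _ hF0)
    (show Ioc a b ≤ Ioi 0 from fun x hx => ha.trans hx.1).eventuallyLE

/-- An integrable function `q` on `(0, δ)` with `q' ≥ |q| / x - K x F` cannot be very negative,
as otherwise it would be below a negative multiple of `1 / x`. -/
theorem neg_le_of_singular_deriv {q F : ℝ → ℝ} {δ K : ℝ} (hK : 0 ≤ K)
    (hq : ∀ a b, 0 < a → 0 < b → AbsolutelyContinuousOnInterval q a b)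
    (hqi : Integrable q halfLine) (hF : Integrable F halfLine) (hF0 : ∀ x, 0 ≤ F x)
    (hd : ∀ᵐ x, x ∈ Ioc 0 δ → |q x| / x - K * x * F x ≤ deriv q x)
    {x : ℝ} (hx : 0 < x) (hxδ : x ≤ δ) : -(K * δ * ∫ y, F y ∂halfLine) ≤ q x := by
  set I := ∫ y, F y ∂halfLine with hI
  have hI0 : 0 ≤ I := integral_nonneg hF0
  by_contra! hlt
  set m := -(x * q x + K * x ^ 2 * I) with hm
  have hm0 : 0 < m := by
    have h1 : K * x * I ≤ K * δ * I := by gcongr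
    have h2 : 0 < x * (-q x - K * x * I) := mul_pos hx (by linarith)
    rw [hm]; nlinarith
  -- Integrate `(t q)' = q + t q' ≥ q + |q| - K t² F ≥ -K x² F` from `a` to `x`: the singular term
  -- `|q| / t` exactly absorbs the sign of `q`.
  have key : ∀ a, 0 < a → a < x → m ≤ -(a * q a) := by
    intro a ha hax
    have hid : AbsolutelyContinuousOnInterval (fun t : ℝ => t) a x :=
      contDiff_id.contDiffOn.absolutelyContinuousOnInterval
    have hac := hid.fun_mul (hq a x ha hx)
    have hint : IntervalIntegrable (fun t => -(K * x ^ 2) * F t) volume a x :=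
      (intervalIntegrable_of_halfLine hF ha hax.le).const_mul _
    have h := integral_le_sub_of_le_deriv hax.le hac hint ?_
    · rw [intervalIntegral.integral_const_mul] at h
      have h2 := intervalIntegral_le_halfLine hF hF0 ha hax.le
      have : K * x ^ 2 * (∫ t in a..x, F t) ≤ K * x ^ 2 * I := by gcongr
      rw [hm]; linarith
    · filter_upwards [hd, (hq a x ha hx).ae_differentiableAt] with t ht htd hta
      have ht0 : 0 < t := ha.trans hta.1
      have h1 := ht ⟨ht0, hta.2.trans hxδ⟩
      have hdq := (htd (by rw [uIcc_of_le hax.le]; exact ⟨hta.1.le, hta.2⟩)).hasDerivAt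
      rw [((hasDerivAt_id' t).fun_mul hdq).deriv]
      have h3 : t * (|q t| / t - K * t * F t) ≤ t * deriv q t := by gcongr
      have h4 : t * (|q t| / t - K * t * F t) = |q t| - K * t ^ 2 * F t := by
        field_simp
      have h5 : K * t ^ 2 * F t ≤ K * x ^ 2 * F t := by
        have := hF0 t
        gcongr
        exact hta.2
      linarith [neg_abs_le (q t)]
  -- Now `1 / t ≤ |q(t)| / m` on (0, x), so integrability of `q` would force that of `1 / t` at 0.
  have hinv : IntervalIntegrable (fun t : ℝ => t⁻¹) volume 0 x := by
    rw [intervalIntegrable_iff_integrableOn_Ioo_of_le hx.le]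
    have hqx : IntegrableOn (fun t => m⁻¹ * ‖q t‖) (Ioo 0 x) :=
      (IntegrableOn.mono_set hqi fun t ht => ht.1).norm.const_mul _
    refine hqx.mono' measurable_inv.aestronglyMeasurable ?_
    refine (ae_restrict_iff' measurableSet_Ioo).2 (ae_of_all _ fun t ht => ?_)
    have h1 := key t ht.1 ht.2
    rw [Real.norm_of_nonneg (inv_nonneg.2 ht.1.le), Real.norm_eq_abs, inv_mul_eq_div,
      le_div_iff₀ hm0, inv_mul_le_iff₀ ht.1]
    nlinarith [neg_abs_le (q t), ht.1]
  rw [intervalIntegrable_inv_iff] at hinv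
  rcases hinv with h | h
  · exact hx.ne h
  · exact h (by simp)

/-- Discard the nonnegative term `|q| / x` and integrate from `x` to `δ`; no integrability of `q` is
involved, unlike in the lower bound. -/
theorem le_of_singular_deriv {q F : ℝ → ℝ} {δ K : ℝ} (hK : 0 ≤ K)
    (hq : ∀ a b, 0 < a → 0 < b → AbsolutelyContinuousOnInterval q a b)
    (hF : Integrable F halfLine) (hF0 : ∀ x, 0 ≤ F x)
    (hd : ∀ᵐ x, x ∈ Ioc 0 δ → |q x| / x - K * x * F x ≤ deriv q x)
    {x : ℝ} (hx : 0 < x) (hxδ : x ≤ δ) : q x ≤ q δ + K * δ * ∫ y, F y ∂halfLine := by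
  have hδ := hx.trans_le hxδ
  have hint : IntervalIntegrable (fun t => -(K * δ) * F t) volume x δ :=
    (intervalIntegrable_of_halfLine hF hx hxδ).const_mul _
  have h := integral_le_sub_of_le_deriv hxδ (hq x δ hx hδ) hint ?_
  · rw [intervalIntegral.integral_const_mul] at h
    have h2 := intervalIntegral_le_halfLine hF hF0 hx hxδ
    have : K * δ * (∫ t in x..δ, F t) ≤ K * δ * ∫ y, F y ∂halfLine := by gcongr
    linarith
  · filter_upwards [hd] with t ht hta
    have ht0 : 0 < t := hx.trans hta.1
    have h1 := ht ⟨ht0, hta.2⟩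
    have h3 : 0 ≤ |q t| / t := by positivity
    have h5 : K * t * F t ≤ K * δ * F t := by
      have := hF0 t
      gcongr
      exact hta.2
    linarith

/-- A Sobolev type bound on a half-line away from the origin. -/
theorem le_integral_of_abs_deriv_le {p F : ℝ → ℝ} {δ : ℝ} (hδ : 0 < δ)
    (hp : ∀ a b, 0 < a → 0 < b → AbsolutelyContinuousOnInterval p a b)
    (hpi : Integrable p halfLine) (hp0 : ∀ x, 0 ≤ p x)
    (hF : Integrable F halfLine) (hF0 : ∀ x, 0 ≤ F x)
    (hd : ∀ᵐ x, x ∈ Ici δ → |deriv p x| ≤ F x)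
    {x : ℝ} (hx : δ ≤ x) : p x ≤ (∫ y, p y ∂halfLine) + ∫ y, F y ∂halfLine := by
  have hx0 := hδ.trans_le hx
  -- Some point of the unit interval to the right of `x` has a value at most the mean of `p` there.
  obtain ⟨y, hy, hpy⟩ : ∃ y ∈ Ioc x (x + 1), p y ≤ ∫ y, p y ∂halfLine := by
    have h := exists_le_setAverage (μ := volume) (s := Ioc x (x + 1)) (f := p) (by simp) (by simp)
      (intervalIntegrable_of_halfLine hpi hx0 (by linarith)).1
    obtain ⟨y, hy, h⟩ := h
    refine ⟨y, hy, h.trans ?_⟩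
    rw [setAverage_eq, ← intervalIntegral.integral_of_le (by linarith)]
    simpa using intervalIntegral_le_halfLine hpi hp0 hx0 (by linarith : x ≤ x + 1)
  have hint : IntervalIntegrable (fun t => -F t) volume x y :=
    (intervalIntegrable_of_halfLine hF hx0 hy.1.le).neg
  have h := integral_le_sub_of_le_deriv hy.1.le (hp x y hx0 (hx0.trans hy.1)) hint ?_
  · rw [intervalIntegral.integral_neg] at h
    have h2 := intervalIntegral_le_halfLine hF hF0 hx0 hy.1.le
    linarith
  · filter_upwards [hd] with t ht hta
    linarith [neg_abs_le (deriv p t), ht (hx.trans hta.1.le)]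

/-! ### Matrices as operators, and the system solved for the derivative -/

/-- The bounded operator of the Euclidean plane given by a matrix. -/
noncomputable abbrev toOp (A : Mat) : Plane →L[ℝ] Plane := Matrix.toEuclideanCLM (n := Fin 2) (𝕜 := ℝ) A

theorem app_eq_toOp (A : Mat) (v : Plane) : app A v = toOp A v := rfl

theorem norm_app_le (A : Mat) (v : Plane) : ‖app A v‖ ≤ ‖A‖ * ‖v‖ :=
  (toOp A).le_opNorm v

theorem toOp_mul (A B : Mat) (v : Plane) : toOp (A * B) v = toOp A (toOp B v) := by
  simp only [toOp, map_mul]; rfl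

theorem J_mul_J : J * J = -1 := by
  ext i j; fin_cases i <;> fin_cases j <;> simp [J, Matrix.mul_apply, Fin.sum_univ_two]

/-- Multiply `τ z = J z' + P z` by `-J`, the inverse of `J`. -/
theorem deriv_eq_of_tau (P : ℝ → Mat) (z : ℝ → Plane) (x : ℝ) :
    deriv z x = toOp (J * P x) (z x) + toOp (-J) (tau P z x) := by
  simp only [tau, app_eq_toOp, map_add, ← toOp_mul, neg_mul, J_mul_J, neg_neg]
  simp [toOp]

/-- For symmetric `Q` the matrix `J Q` has trace 0 and determinant `det Q`, so this is
Cayley–Hamilton. For `Q = P*` it gives the eigenvalues `±l` that drive the behaviour at 0. -/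
theorem J_mul_sq {Q : Mat} (hQ : Q.IsSymm) : J * Q * (J * Q) = (-Q.det) • (1 : Mat) := by
  have h := hQ.apply 0 1
  have hJQ : J * Q = !![Q 1 0, Q 1 1; -Q 0 0, -Q 0 1] := by
    ext i j; fin_cases i <;> fin_cases j <;> simp [J, Matrix.mul_apply, Fin.sum_univ_two]
  rw [hJQ, Matrix.det_fin_two]
  ext i j; fin_cases i <;> fin_cases j <;>
    simp [Matrix.mul_apply, Fin.sum_univ_two, h] <;> ring

/-! ### The indefinite Lyapunov form -/

section Lyapunov

variable {E : Type*} [NormedAddCommGroup E] [InnerProductSpace ℝ E]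

/-- The parallelogram law for `A w` and `l w`, with the term `2 ‖A w‖²` dropped. It recovers `|w|²`
from the two components of the form. -/
theorem two_mul_normSq_le {A : E →L[ℝ] E} (l : ℝ) (w : E) :
    2 * l ^ 2 * ‖w‖ ^ 2 ≤ ‖(A + l • 1) w‖ ^ 2 + ‖(A - l • 1) w‖ ^ 2 := by
  have h := parallelogram_law_with_norm ℝ (A w) (l • w)
  simp only [add_apply, sub_apply, smul_apply, one_apply_eq_self]
  rw [norm_smul, Real.norm_eq_abs] at h
  have h2 : |l| * |l| = l ^ 2 := by rw [← sq, sq_abs]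
  nlinarith [sq_nonneg ‖A w‖]

theorem neg_le_two_mul_inner {c : ℝ} (hc : 0 < c) (u v : E) :
    -(c * ‖u‖ ^ 2 + c⁻¹ * ‖v‖ ^ 2) ≤ 2 * ⟪u, v⟫ := by
  have h := abs_real_inner_le_norm u v
  have h1 := neg_abs_le ⟪u, v⟫
  have h2 : 0 ≤ c⁻¹ * (c * ‖u‖ - ‖v‖) ^ 2 := by positivity
  have h3 : c⁻¹ * (c * ‖u‖ - ‖v‖) ^ 2 = c * ‖u‖ ^ 2 - 2 * (‖u‖ * ‖v‖) + c⁻¹ * ‖v‖ ^ 2 := by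
    field_simp
    ring
  linarith

theorem two_mul_inner_le {c : ℝ} (hc : 0 < c) (u v : E) :
    2 * ⟪u, v⟫ ≤ c * ‖u‖ ^ 2 + c⁻¹ * ‖v‖ ^ 2 := by
  have h := neg_le_two_mul_inner hc u (-v)
  rw [inner_neg_right, norm_neg] at h
  linarith

theorem abs_inner_apply_le (U T : E →L[ℝ] E) (w : E) :
    |⟪U w, U (T w)⟫| ≤ ‖U‖ ^ 2 * ‖T‖ * ‖w‖ ^ 2 := by
  calc |⟪U w, U (T w)⟫| ≤ ‖U w‖ * ‖U (T w)‖ := abs_real_inner_le_norm _ _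
    _ ≤ (‖U‖ * ‖w‖) * (‖U‖ * (‖T‖ * ‖w‖)) := by
        gcongr
        · exact U.le_opNorm w
        · exact U.le_opNorm_of_le (T.le_opNorm w)
    _ = _ := by ring

/-- The indefinite form `‖U w‖² - k ‖V w‖²`, with `U = A + l` and `V = A - l`, is a Lyapunov
function for perturbations of `w' = s A w` when `A² = l²`. -/
theorem lyapunov_le {A R : E →L[ℝ] E} {l k η κ s x : ℝ} (hl : 0 < l) (hk : 1 ≤ k)
    (hA : ∀ v, A (A v) = l ^ 2 • v) (hκ : 0 < κ) (hx : 0 < x) (hs : 0 ≤ s)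
    (hR : ‖R - A‖ * (‖A + l • 1‖ ^ 2 + k * ‖A - l • 1‖ ^ 2) ≤ η * l ^ 2)
    (hxs : 1 + κ ≤ x * s * (2 * l - η)) (w h : E) :
    |‖(A + l • 1) w‖ ^ 2 - k * ‖(A - l • 1) w‖ ^ 2| / x
        - κ⁻¹ * (‖A + l • 1‖ ^ 2 + k * ‖A - l • 1‖ ^ 2) * x * ‖h‖ ^ 2 ≤
      2 * ⟪(A + l • 1) w, (A + l • 1) (s • R w + h)⟫
        - k * (2 * ⟪(A - l • 1) w, (A - l • 1) (s • R w + h)⟫) := by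
  -- Because `A² = l²`, `U` and `V` intertwine `A` with `l` and `-l`. Both terms of `‖U w‖² - k ‖V
  -- w‖²` thus have nonnegative derivative along `w' = s A w`, with sum `2 s l (‖U w‖² + k ‖V w‖²)`.
  have hUA : ∀ v, (A + l • 1) (A v) = l • (A + l • 1) v := by
    intro v; simp [hA, sq, mul_smul, add_comm]
  have hVA : ∀ v, (A - l • 1) (A v) = -(l • (A - l • 1) v) := by
    intro v; simp [hA, sq, mul_smul, smul_sub]
  have hlow := two_mul_normSq_le (A := A) l w
  generalize hUdef : A + l • (1 : E →L[ℝ] E) = U at *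
  generalize hVdef : A - l • (1 : E →L[ℝ] E) = V at *
  have hRw : R w = A w + (R - A) w := by simp
  set D := R - A
  set N := ‖U w‖ ^ 2 + k * ‖V w‖ ^ 2 with hN
  set M := ‖U‖ ^ 2 + k * ‖V‖ ^ 2 with hM
  have hM0 : 0 ≤ M := by positivity
  have hN0 : 0 ≤ N := by positivity
  have hlowN : 2 * l ^ 2 * ‖w‖ ^ 2 ≤ N := by
    nlinarith [sq_nonneg ‖V w‖]
  have hη : 0 ≤ η := by
    have : 0 ≤ η * l ^ 2 := le_trans (by positivity) hR
    exact nonneg_of_mul_nonneg_left this (by positivity)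
  -- the unperturbed and perturbed linear parts
  have hlin : (2 * l - η) * N ≤ 2 * ⟪U w, U (R w)⟫ - k * (2 * ⟪V w, V (R w)⟫) := by
    have e1 : ⟪U w, U (R w)⟫ = l * ‖U w‖ ^ 2 + ⟪U w, U (D w)⟫ := by
      rw [hRw, map_add, hUA, inner_add_right, inner_smul_right, real_inner_self_eq_norm_sq]
    have e2 : ⟪V w, V (R w)⟫ = -(l * ‖V w‖ ^ 2) + ⟪V w, V (D w)⟫ := by
      rw [hRw, map_add, hVA, inner_add_right, inner_neg_right, inner_smul_right,
        real_inner_self_eq_norm_sq]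
    have b1 := (abs_le.1 (abs_inner_apply_le U D w)).1
    have b2 := (abs_le.1 (abs_inner_apply_le V D w)).2
    have b3 : k * ⟪V w, V (D w)⟫ ≤ k * (‖V‖ ^ 2 * ‖D‖ * ‖w‖ ^ 2) := by gcongr
    have b4 : ‖D‖ * M * ‖w‖ ^ 2 ≤ η * l ^ 2 * ‖w‖ ^ 2 := by gcongr
    have b5 : η * (2 * l ^ 2 * ‖w‖ ^ 2) ≤ η * N := by gcongr
    rw [e1, e2]
    have : ‖D‖ * M * ‖w‖ ^ 2 = ‖U‖ ^ 2 * ‖D‖ * ‖w‖ ^ 2 + k * (‖V‖ ^ 2 * ‖D‖ * ‖w‖ ^ 2) := by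
      rw [hM]; ring
    rw [hN] at b5 ⊢
    linarith
  have hforce : -((κ / x) * N + κ⁻¹ * M * x * ‖h‖ ^ 2) ≤
      2 * ⟪U w, U h⟫ - k * (2 * ⟪V w, V h⟫) := by
    -- Young's inequality with weight `κ / x`: the cost `(κ / x) N` is paid by the surplus `κ` in
    -- the rate condition, leaving `N / x`, which dominates `|q| / x`.
    have hc : 0 < κ / x := by positivity
    have b1 := neg_le_two_mul_inner hc (U w) (U h)
    have b2 := two_mul_inner_le hc (V w) (V h)
    have b3 : k * (2 * ⟪V w, V h⟫) ≤ k * (κ / x * ‖V w‖ ^ 2 + (κ / x)⁻¹ * ‖V h‖ ^ 2) := by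
      gcongr
    have b4 : ‖U h‖ ^ 2 + k * ‖V h‖ ^ 2 ≤ M * ‖h‖ ^ 2 := by
      have u1 : ‖U h‖ ^ 2 ≤ (‖U‖ * ‖h‖) ^ 2 := by gcongr; exact U.le_opNorm h
      have u2 : ‖V h‖ ^ 2 ≤ (‖V‖ * ‖h‖) ^ 2 := by gcongr; exact V.le_opNorm h
      have u3 : k * ‖V h‖ ^ 2 ≤ k * (‖V‖ * ‖h‖) ^ 2 := by gcongr
      rw [hM]; linarith [mul_pow ‖U‖ ‖h‖ 2, mul_pow ‖V‖ ‖h‖ 2]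
    have b5 : (κ / x)⁻¹ * (‖U h‖ ^ 2 + k * ‖V h‖ ^ 2) ≤ (κ / x)⁻¹ * (M * ‖h‖ ^ 2) := by gcongr
    have e : (κ / x)⁻¹ * (M * ‖h‖ ^ 2) = κ⁻¹ * M * x * ‖h‖ ^ 2 := by
      rw [inv_div]; ring
    rw [hN]
    linarith
  have habs : |‖U w‖ ^ 2 - k * ‖V w‖ ^ 2| ≤ N := by
    have : 0 ≤ k * ‖V w‖ ^ 2 := by positivity
    rw [hN, abs_le]; constructor <;> nlinarith [sq_nonneg ‖U w‖]
  have hmain : (1 + κ) / x * N ≤ s * ((2 * l - η) * N) := by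
    have : (1 + κ) / x ≤ s * (2 * l - η) := by
      rw [div_le_iff₀ hx]; linarith
    calc _ ≤ s * (2 * l - η) * N := by gcongr
      _ = _ := by ring
  have hlin' : s * ((2 * l - η) * N) ≤ s * (2 * ⟪U w, U (R w)⟫ - k * (2 * ⟪V w, V (R w)⟫)) := by
    gcongr
  have hq : |‖U w‖ ^ 2 - k * ‖V w‖ ^ 2| / x ≤ N / x := by gcongr
  have hsplit : (1 + κ) / x * N = N / x + κ / x * N := by ring
  simp only [map_add, map_smul, inner_add_right, inner_smul_right]
  linarith

end Lyapunov

/-! ### The sup bound by the graph norm -/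

/-- The rate condition at the singular endpoint. -/
theorem eventually_rate {β l : ℝ} (hβ : 1 ≤ β) (hl : 0 < l) (hl1 : β = 1 → 1 / 2 < l) :
    ∃ η > 0, ∃ κ > 0, ∀ᶠ x in 𝓝[>] (0 : ℝ), 1 + κ ≤ x * x ^ (-β) * (2 * l - η) := by
  -- For `β = 1` the factor `x * x ^ (-β)` is 1, and the surplus `2 l - 1 > 0` is shared equally
  -- between `η` and `κ`. For `β > 1` the factor blows up at 0, so any `l > 0` suffices.
  rcases hβ.eq_or_lt with h | h
  · have := hl1 h.symm
    refine ⟨(2 * l - 1) / 2, by linarith, (2 * l - 1) / 2, by linarith, ?_⟩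
    filter_upwards [self_mem_nhdsWithin] with x hx
    have hx : 0 < x := hx
    rw [← h, Real.rpow_neg_one, mul_inv_cancel₀ hx.ne']
    linarith
  · refine ⟨l, hl, 1, one_pos, ?_⟩
    have ht := (tendsto_rpow_neg_nhdsGT_zero (y := 1 - β) (by linarith))
    filter_upwards [ht.eventually_ge_atTop (2 / l), self_mem_nhdsWithin] with x hx hx0
    have hx0 : 0 < x := hx0
    rw [show x * x ^ (-β) = x ^ (1 - β) by rw [sub_eq_add_neg, Real.rpow_add hx0, Real.rpow_one]]
    rw [div_le_iff₀ hl] at hx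
    linarith

theorem integrable_normSq {z : ℝ → Plane} (hz : MemLp z 2 halfLine) :
    Integrable (fun x => ‖z x‖ ^ 2) halfLine := hz.norm.integrable_sq

theorem integrable_normSq_comp {z : ℝ → Plane} (hz : MemLp z 2 halfLine)
    (T : Plane →L[ℝ] Plane) : Integrable (fun x => ‖T (z x)‖ ^ 2) halfLine :=
  integrable_normSq (T.comp_memLp' hz)

theorem hasDerivAt_normSq_comp {z : ℝ → Plane} {x : ℝ} (hz : DifferentiableAt ℝ z x)
    (T : Plane →L[ℝ] Plane) :
    HasDerivAt (fun x => ‖T (z x)‖ ^ 2) (2 * ⟪T (z x), T (deriv z x)⟫) x :=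
  (T.hasFDerivAt.comp_hasDerivAt x hz.hasDerivAt).norm_sq

/-- The Lyapunov form is used with two weights: `k = 1` bounded above from its value at `δ`, and `k
= 2` bounded below because `z` is square integrable at 0. A single weight would not do, since each
form is indefinite. -/
theorem exists_bound_near_zero {μm μp : ℝ} {P : ℝ → Mat} (hP : IsPotential μm μp P) :
    ∃ δ > 0, ∃ C ≥ 0, ∀ z : ℝ → Plane, LocAC z → MemLp z 2 halfLine →
      MemLp (tau P z) 2 halfLine → ∀ x, 0 < x → x ≤ δ →
      ‖z x‖ ^ 2 ≤ C * (‖z δ‖ ^ 2 + ∫ y, ‖tau P z y‖ ^ 2 ∂halfLine) := by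
  obtain ⟨β, Pz, ⟨hβ, hPz, hlim, -⟩, hdet1, hdet2⟩ := hP.atZero
  have hdet : Pz.det < 0 := by
    rcases hβ.eq_or_lt with h | h
    · linarith [hdet1 h.symm]
    · exact hdet2 h
  set l := √(-Pz.det) with hl_def
  have hl : 0 < l := Real.sqrt_pos.2 (by linarith)
  have hl2 : l ^ 2 = -Pz.det := Real.sq_sqrt (by linarith)
  have hl1 : β = 1 → 1 / 2 < l := fun h => by
    have := hdet1 h
    exact Real.lt_sqrt_of_sq_lt (by linarith)
  obtain ⟨η, hη, κ, hκ, hrate⟩ := eventually_rate hβ hl hl1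
  set A : Plane →L[ℝ] Plane := toOp (J * Pz) with hA_def
  have hA : ∀ v, A (A v) = l ^ 2 • v := fun v => by
    rw [hA_def, ← toOp_mul, J_mul_sq hPz, ← hl2]
    simp [toOp]
  let R : ℝ → Plane →L[ℝ] Plane := fun x => toOp (J * (x ^ β • P x))
  set U := A + l • (1 : Plane →L[ℝ] Plane) with hU
  set V := A - l • (1 : Plane →L[ℝ] Plane) with hV
  have hR : Tendsto (fun x => ‖R x - A‖) (𝓝[>] 0) (𝓝 0) := by
    have h1 : Tendsto (fun x => ‖J * (x ^ β • P x) - J * Pz‖) (𝓝[>] 0) (𝓝 0) :=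
      tendsto_iff_norm_sub_tendsto_zero.1 (hlim.const_mul J)
    refine h1.congr fun x => ?_
    rw [hA_def, ← map_sub, Matrix.l2_opNorm_toEuclideanCLM]
  have hRk : ∀ k : ℝ, ∀ᶠ x in 𝓝[>] (0 : ℝ), ‖R x - A‖ * (‖U‖ ^ 2 + k * ‖V‖ ^ 2) ≤ η * l ^ 2 :=
    fun k => by
      have h2 := hR.mul_const (‖U‖ ^ 2 + k * ‖V‖ ^ 2)
      rw [zero_mul] at h2
      exact h2.eventually_le_const (by positivity)
  obtain ⟨δ, hδ : 0 < δ, hδs⟩ := mem_nhdsGT_iff_exists_Ioc_subset.1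
    (hrate.and ((hRk 1).and (hRk 2)))
  let K : ℝ → ℝ := fun k => κ⁻¹ * (‖U‖ ^ 2 + k * ‖V‖ ^ 2) * ‖toOp (-J)‖ ^ 2
  have hK0 : ∀ k, 1 ≤ k → 0 ≤ K k := fun k hk => by
    have : 0 ≤ k := by linarith
    positivity
  -- The weights 3 and 2 come from `‖U z‖² + ‖V z‖² = 3 q₁ - 2 q₂`; the denominator comes from
  -- `two_mul_normSq_le`.
  refine ⟨δ, hδ, (3 * ‖U‖ ^ 2 + (3 * K 1 + 2 * K 2) * δ) / (2 * l ^ 2), ?_, ?_⟩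
  · have := hK0 1 le_rfl
    have := hK0 2 one_le_two
    positivity
  intro z hz hzL hfL x hx hxδ
  let q : ℝ → ℝ → ℝ := fun k x => ‖U (z x)‖ ^ 2 - k * ‖V (z x)‖ ^ 2
  have hF := integrable_normSq hfL
  have hF0 : ∀ x, 0 ≤ ‖tau P z x‖ ^ 2 := fun x => by positivity
  set I := ∫ y, ‖tau P z y‖ ^ 2 ∂halfLine with hI
  have hI0 : 0 ≤ I := integral_nonneg hF0
  have hqac : ∀ k a b, 0 < a → 0 < b → AbsolutelyContinuousOnInterval (q k) a b :=
    fun k a b ha hb => (hz.normSq_comp U ha hb).fun_sub ((hz.normSq_comp V ha hb).const_mul k)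
  have hqi : ∀ k, Integrable (q k) halfLine := fun k =>
    (integrable_normSq_comp hzL U).sub ((integrable_normSq_comp hzL V).const_mul k)
  have hqd : ∀ k, 1 ≤ k → (∀ x ∈ Ioc 0 δ, ‖R x - A‖ * (‖U‖ ^ 2 + k * ‖V‖ ^ 2) ≤ η * l ^ 2) →
      ∀ᵐ x, x ∈ Ioc 0 δ → |q k x| / x - K k * x * ‖tau P z x‖ ^ 2 ≤ deriv (q k) x := by
    intro k hk hRx
    filter_upwards [(ae_restrict_iff' measurableSet_Ioi).1 hz.ae_differentiableAt] with x hzx hx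
    have hzx := hzx hx.1
    have hd := (hasDerivAt_normSq_comp hzx U).sub ((hasDerivAt_normSq_comp hzx V).const_mul k)
    rw [show deriv (q k) x = _ from hd.deriv]
    have hz' : deriv z x = x ^ (-β) • R x (z x) + toOp (-J) (tau P z x) := by
      rw [deriv_eq_of_tau P]
      have : toOp (J * P x) = x ^ (-β) • R x := by
        simp only [R, Matrix.mul_smul, toOp, map_smul, smul_smul]
        rw [Real.rpow_neg hx.1.le, inv_mul_cancel₀ (Real.rpow_pos_of_pos hx.1 _).ne', one_smul]
      rw [this, smul_apply]
    rw [hz']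
    refine le_trans ?_ (lyapunov_le hl hk hA hκ hx.1 (Real.rpow_nonneg hx.1.le _) (hRx x hx)
      (hδs hx).1 (z x) (toOp (-J) (tau P z x)))
    have h1 : ‖toOp (-J) (tau P z x)‖ ^ 2 ≤ (‖toOp (-J)‖ * ‖tau P z x‖) ^ 2 := by
      gcongr
      exact ContinuousLinearMap.le_opNorm _ _
    have hx0 : 0 ≤ x := hx.1.le
    have hk0 : 0 ≤ k := by linarith
    have h2 : κ⁻¹ * (‖U‖ ^ 2 + k * ‖V‖ ^ 2) * x * ‖toOp (-J) (tau P z x)‖ ^ 2 ≤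
        K k * x * ‖tau P z x‖ ^ 2 := by
      calc _ ≤ κ⁻¹ * (‖U‖ ^ 2 + k * ‖V‖ ^ 2) * x * (‖toOp (-J)‖ * ‖tau P z x‖) ^ 2 := by gcongr
        _ = _ := by simp only [K]; ring
    exact sub_le_sub_left h2 _
  have hd1 := hqd 1 le_rfl fun x hx => (hδs hx).2.1
  have hd2 := hqd 2 one_le_two fun x hx => (hδs hx).2.2
  have b1 := le_of_singular_deriv (hK0 1 le_rfl) (hqac 1) hF hF0 hd1 hx hxδ
  have b2 := neg_le_of_singular_deriv (hK0 2 one_le_two) (hqac 2) (hqi 2) hF hF0 hd2 hx hxδ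
  have b3 : 2 * l ^ 2 * ‖z x‖ ^ 2 ≤ ‖U (z x)‖ ^ 2 + ‖V (z x)‖ ^ 2 := two_mul_normSq_le l (z x)
  have b4 : q 1 δ ≤ ‖U‖ ^ 2 * ‖z δ‖ ^ 2 := by
    have : ‖U (z δ)‖ ^ 2 ≤ (‖U‖ * ‖z δ‖) ^ 2 := by
      gcongr
      exact U.le_opNorm _
    have h2 := sq_nonneg ‖V (z δ)‖
    simp only [q]
    rw [mul_pow] at this
    linarith
  rw [div_mul_eq_mul_div, le_div_iff₀ (by positivity)]
  have b5 : ‖U (z x)‖ ^ 2 + ‖V (z x)‖ ^ 2 = 3 * q 1 x - 2 * q 2 x := by simp only [q]; ring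
  have b6 : 0 ≤ (3 * K 1 + 2 * K 2) * δ * ‖z δ‖ ^ 2 := by
    have := hK0 1 le_rfl
    have := hK0 2 one_le_two
    positivity
  have b7 : 0 ≤ 3 * ‖U‖ ^ 2 * I := by positivity
  rw [← hI] at b1 b2
  nlinarith

theorem IsPotential.exists_norm_le {μm μp : ℝ} {P : ℝ → Mat} (hP : IsPotential μm μp P)
    {δ : ℝ} (hδ : 0 < δ) : ∃ K ≥ 0, ∀ x, δ ≤ x → ‖P x‖ ≤ K := by
  have h1 := hP.atTop.1.norm.eventually_le_const (lt_add_one _)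
  obtain ⟨N, hN⟩ := eventually_atTop.1 h1
  obtain ⟨C, hC⟩ := isCompact_Icc.exists_bound_of_continuousOn
    (hP.continuousOn.mono fun x (hx : x ∈ Icc δ N) => hδ.trans_le hx.1)
  refine ⟨max C (‖limitAtTop μm μp‖ + 1), le_max_of_le_right (by positivity), fun x hx => ?_⟩
  rcases le_total x N with h | h
  · exact le_max_of_le_left (hC x ⟨hx, h⟩)
  · exact le_max_of_le_right (hN x h)

theorem norm_deriv_le {P : ℝ → Mat} {x K : ℝ} (z : ℝ → Plane) (hK : ‖P x‖ ≤ K) :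
    ‖deriv z x‖ ≤ ‖J‖ * (K * ‖z x‖ + ‖tau P z x‖) := by
  rw [deriv_eq_of_tau P]
  calc _ ≤ ‖J * P x‖ * ‖z x‖ + ‖-J‖ * ‖tau P z x‖ :=
        norm_add_le_of_le (norm_app_le _ _) (norm_app_le _ _)
    _ ≤ ‖J‖ * K * ‖z x‖ + ‖J‖ * ‖tau P z x‖ := by
        rw [norm_neg]
        gcongr
        exact (norm_mul_le _ _).trans (by gcongr)
    _ = _ := by ring

/-- On [δ, ∞) `P` is bounded, so `(|z|²)' = 2 ⟨z, z'⟩` is dominated by an integrable combination of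
`|z|²` and `|τ z|²`. -/
theorem exists_bound_away_from_zero {μm μp : ℝ} {P : ℝ → Mat} (hP : IsPotential μm μp P)
    {δ : ℝ} (hδ : 0 < δ) : ∃ C ≥ 0, ∀ z : ℝ → Plane, LocAC z → MemLp z 2 halfLine →
      MemLp (tau P z) 2 halfLine → ∀ x, δ ≤ x →
      ‖z x‖ ^ 2 ≤ C * ((∫ y, ‖z y‖ ^ 2 ∂halfLine) + ∫ y, ‖tau P z y‖ ^ 2 ∂halfLine) := by
  obtain ⟨K, hK0, hK⟩ := hP.exists_norm_le hδ
  refine ⟨1 + (2 * ‖J‖ * K + ‖J‖), by positivity, fun z hz hzL hfL x hx => ?_⟩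
  have hp := integrable_normSq hzL
  have hF := integrable_normSq hfL
  have hG := (hp.const_mul (2 * ‖J‖ * K + ‖J‖)).add (hF.const_mul ‖J‖)
  have h := le_integral_of_abs_deriv_le (p := fun x => ‖z x‖ ^ 2) hδ
    (fun a b ha hb => hz.normSq_comp (ContinuousLinearMap.id ℝ Plane) ha hb) hp
    (fun x => by positivity) hG (fun x => by simp only [Pi.add_apply]; positivity) ?_ hx
  · simp only [Pi.add_apply] at h
    rw [integral_add (hp.const_mul _) (hF.const_mul _), integral_const_mul,
      integral_const_mul] at h
    have h1 : 0 ≤ ∫ y, ‖z y‖ ^ 2 ∂halfLine := integral_nonneg fun _ => by positivity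
    have h2 : 0 ≤ ∫ y, ‖tau P z y‖ ^ 2 ∂halfLine := integral_nonneg fun _ => by positivity
    have h3 : 0 ≤ (1 + 2 * ‖J‖ * K) * ∫ y, ‖tau P z y‖ ^ 2 ∂halfLine := by positivity
    linarith
  · filter_upwards [(ae_restrict_iff' measurableSet_Ioi).1 hz.ae_differentiableAt] with y hzy hy
    have hd := hasDerivAt_normSq_comp (hzy (hδ.trans_le hy)) (ContinuousLinearMap.id ℝ Plane)
    rw [show deriv (fun x => ‖z x‖ ^ 2) y = _ from hd.deriv]
    simp only [ContinuousLinearMap.id_apply, Pi.add_apply, abs_mul, Nat.abs_ofNat]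
    have h1 := abs_real_inner_le_norm (z y) (deriv z y)
    have h2 : ‖z y‖ * ‖deriv z y‖ ≤ ‖z y‖ * (‖J‖ * (K * ‖z y‖ + ‖tau P z y‖)) := by
      gcongr
      exact norm_deriv_le z (hK y hy)
    have h3 : 0 ≤ ‖J‖ * (‖z y‖ - ‖tau P z y‖) ^ 2 := by positivity
    nlinarith

/-- Functions in the domain are bounded by their graph norm. -/
theorem exists_sup_bound {μm μp : ℝ} {P : ℝ → Mat} (hP : IsPotential μm μp P) :
    ∃ C ≥ 0, ∀ z : ℝ → Plane, LocAC z → MemLp z 2 halfLine →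
      MemLp (tau P z) 2 halfLine → ∀ x, 0 < x →
      ‖z x‖ ^ 2 ≤ C * ((∫ y, ‖z y‖ ^ 2 ∂halfLine) + ∫ y, ‖tau P z y‖ ^ 2 ∂halfLine) := by
  obtain ⟨δ, hδ, C, hC0, hC⟩ := exists_bound_near_zero hP
  obtain ⟨D, hD0, hD⟩ := exists_bound_away_from_zero hP hδ
  refine ⟨C * (D + 1) + D, by positivity, fun z hz hzL hfL x hx => ?_⟩
  have h1 : 0 ≤ ∫ y, ‖z y‖ ^ 2 ∂halfLine := integral_nonneg fun _ => by positivity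
  have h2 : 0 ≤ ∫ y, ‖tau P z y‖ ^ 2 ∂halfLine := integral_nonneg fun _ => by positivity
  rcases le_total x δ with h | h
  · refine (hC z hz hzL hfL x hx h).trans ?_
    -- The boundary value `z(δ)` in the estimate near 0 is itself covered by the estimate away from
    -- 0.
    have h3 := hD z hz hzL hfL δ le_rfl
    calc _ ≤ C * ((D + 1) *
          ((∫ y, ‖z y‖ ^ 2 ∂halfLine) + ∫ y, ‖tau P z y‖ ^ 2 ∂halfLine)) := by
          gcongr; linarith
      _ = C * (D + 1) * ((∫ y, ‖z y‖ ^ 2 ∂halfLine) + ∫ y, ‖tau P z y‖ ^ 2 ∂halfLine) := by ring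
      _ ≤ _ := by gcongr; linarith
  · refine (hD z hz hzL hfL x h).trans ?_
    gcongr
    have : 0 ≤ C * (D + 1) := by positivity
    linarith

/-! ### Norms in terms of the continuous representative -/

theorem L2_norm_sq (g : L2) : ‖g‖ ^ 2 = ∫ x, ‖g x‖ ^ 2 ∂halfLine := by
  rw [← real_inner_self_eq_norm_sq, L2.inner_def]
  simp only [real_inner_self_eq_norm_sq]

theorem L2_norm_sq_of_ae {g : L2} {z : ℝ → Plane} (h : g =ᵐ[halfLine] z) :
    ‖g‖ ^ 2 = ∫ x, ‖z x‖ ^ 2 ∂halfLine := by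
  rw [L2_norm_sq]
  exact integral_congr_ae (h.mono fun x hx => by simp only [hx])

theorem L2_norm_sq_le {g : L2} {z : ℝ → Plane} {G : ℝ → ℝ} (h : g =ᵐ[halfLine] z)
    (hG : Integrable G halfLine) (hle : ∀ x > 0, ‖z x‖ ^ 2 ≤ G x) :
    ‖g‖ ^ 2 ≤ ∫ x, G x ∂halfLine := by
  rw [L2_norm_sq_of_ae h]
  refine integral_mono_of_nonneg (ae_of_all _ fun x => by positivity) hG ?_
  exact (ae_restrict_iff' measurableSet_Ioi).2 (ae_of_all _ hle)

/-- The locally absolutely continuous representative of an element of the graph space. -/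
noncomputable def D0Graph.rep {P : ℝ → Mat} (f : D0Graph P) : ℝ → Plane :=
  DiracHalfLine.rep (P := P) f

section Rep

variable {P : ℝ → Mat} (f : D0Graph P)

theorem D0Graph.toL2_ae_eq : f.toL2 =ᵐ[halfLine] f.rep := coe_ae_eq_rep (P := P) f

theorem D0Graph.locAC_rep : LocAC f.rep := DiracHalfLine.locAC_rep (P := P) f

theorem D0Graph.memLp_rep : MemLp f.rep 2 halfLine :=
  (memLp_congr_ae f.toL2_ae_eq).1 (Lp.memLp _)

theorem D0Graph.memLp_tau_rep : MemLp (tau P f.rep) 2 halfLine :=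
  DiracHalfLine.memLp_tau_rep (P := P) f

theorem D0Graph.norm_toL2_sq : ‖f.toL2‖ ^ 2 = ∫ x, ‖f.rep x‖ ^ 2 ∂halfLine :=
  L2_norm_sq_of_ae f.toL2_ae_eq

theorem D0Graph.norm_apply_sq : ‖f.apply‖ ^ 2 = ∫ x, ‖tau P f.rep x‖ ^ 2 ∂halfLine :=
  L2_norm_sq_of_ae (MemLp.coeFn_toLp f.memLp_tau_rep)

theorem D0Graph.norm_toL2_le : ‖f.toL2‖ ≤ ‖f‖ :=
  le_of_sq_le_sq (by rw [f.norm_sq]; nlinarith [sq_nonneg ‖f.apply‖]) (norm_nonneg f)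

theorem D0Graph.norm_apply_le : ‖f.apply‖ ≤ ‖f‖ :=
  le_of_sq_le_sq (by rw [f.norm_sq]; nlinarith [sq_nonneg ‖f.toL2‖]) (norm_nonneg f)

end Rep

theorem D0Graph.exists_norm_rep_le {μm μp : ℝ} {P : ℝ → Mat} (hP : IsPotential μm μp P) :
    ∃ C ≥ 0, ∀ (f : D0Graph P) (x : ℝ), 0 < x → ‖f.rep x‖ ≤ C * ‖f‖ := by
  obtain ⟨C, hC0, hC⟩ := exists_sup_bound hP
  refine ⟨√C, Real.sqrt_nonneg _, fun f x hx => ?_⟩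
  have h := hC f.rep f.locAC_rep f.memLp_rep f.memLp_tau_rep x hx
  rw [← f.norm_toL2_sq, ← f.norm_apply_sq, ← f.norm_sq] at h
  refine le_of_sq_le_sq ?_ (by positivity)
  rwa [mul_pow, Real.sq_sqrt hC0]

/-! ### Equicontinuity and Arzelà–Ascoli on compact intervals -/

/-- Bounded sets of the graph space are equicontinuous away from the origin. -/
theorem D0Graph.exists_modulus {μm μp : ℝ} {P : ℝ → Mat} (hP : IsPotential μm μp P)
    {a : ℝ} (ha : 0 < a) {r : ℝ} (hr : 0 ≤ r) : ∃ C ≥ 0, ∀ f : D0Graph P, ‖f‖ ≤ r →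
      ∀ x y, a ≤ x → a ≤ y → ‖f.rep x - f.rep y‖ ^ 2 ≤ C * (|x - y| + √|x - y|) := by
  obtain ⟨C, hC0, hC⟩ := D0Graph.exists_norm_rep_le hP
  obtain ⟨K, hK0, hK⟩ := hP.exists_norm_le ha
  set R := C * r with hR
  have hR0 : 0 ≤ R := by positivity
  refine ⟨4 * R * ‖J‖ * (K * R + 1 + r ^ 2), by positivity, fun f hf x y hx hy => ?_⟩
  wlog hyx : y ≤ x generalizing x y
  · rw [norm_sub_rev, abs_sub_comm]
    exact this y x hy hx (le_of_not_ge hyx)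
  rcases hyx.eq_or_lt with h | hlt
  · simp [h]
  have hb : ∀ t, 0 < t → ‖f.rep t‖ ≤ R := fun t ht => (hC f t ht).trans (by rw [hR]; gcongr)
  have hxy : 0 < x - y := sub_pos.2 hlt
  rw [abs_of_pos hxy]
  -- In place of Cauchy–Schwarz, `|τ z| ≤ 1 / s + s |τ z|²` is integrated over [y, x]; with `s = √(x
  -- - y)` the two contributions are at most `s` and `s r²`.
  set s := √(x - y) with hs
  have hs0 : 0 < s := Real.sqrt_pos.2 hxy
  have hss : s * s = x - y := Real.mul_self_sqrt hxy.le
  have hy0 := ha.trans_le hy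
  have hF := integrable_normSq f.memLp_tau_rep
  -- Subtracting the constant `z(y)` makes the squared norm vanish at `y`, so its increment over [y,
  -- x] is `|z(x) - z(y)|²`.
  have hw : LocAC (f.rep + fun _ => -f.rep y) := f.locAC_rep.add fun a b _ _ =>
    (contDiff_const.contDiffOn (n := 1)).absolutelyContinuousOnInterval
  let ψ : ℝ → ℝ := fun t => 4 * R * ‖J‖ * (K * R + s⁻¹) + 4 * R * ‖J‖ * s * ‖tau P f.rep t‖ ^ 2
  have hFi := (intervalIntegrable_of_halfLine hF hy0 hyx).const_mul (4 * R * ‖J‖ * s)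
  have hψ : IntervalIntegrable ψ volume y x := intervalIntegrable_const.add hFi
  have h := sub_le_integral_of_deriv_le hyx
    (hw.normSq_comp (ContinuousLinearMap.id ℝ Plane) hy0 (hy0.trans hlt)) hψ ?_
  · simp only [Pi.add_apply, ContinuousLinearMap.id_apply, add_neg_cancel, norm_zero,
      ← sub_eq_add_neg] at h
    rw [intervalIntegral.integral_add intervalIntegrable_const hFi,
      intervalIntegral.integral_const, intervalIntegral.integral_const_mul, smul_eq_mul] at h
    have h1 := intervalIntegral_le_halfLine hF (fun t => by positivity) hy0 hyx
    rw [← f.norm_apply_sq] at h1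
    have h2 : ‖f.apply‖ ^ 2 ≤ r ^ 2 := by
      gcongr
      exact f.norm_apply_le.trans hf
    have h3 : 4 * R * ‖J‖ * s * (∫ t in y..x, ‖tau P f.rep t‖ ^ 2) ≤ 4 * R * ‖J‖ * s * r ^ 2 := by
      gcongr
      exact h1.trans h2
    have h4 : (x - y) * (4 * R * ‖J‖ * (K * R + s⁻¹)) =
        4 * R * ‖J‖ * (K * R * (x - y) + s) := by
      have : (x - y) * s⁻¹ = s := by rw [← hss]; field_simp
      linear_combination (4 * R * ‖J‖) * this
    have h5 : 0 ≤ 4 * R * ‖J‖ * (K * R * s + (1 + r ^ 2) * (x - y)) := by positivity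
    rw [h4] at h
    nlinarith
  · filter_upwards [(ae_restrict_iff' measurableSet_Ioi).1 hw.ae_differentiableAt] with t hwt ht
    have ht0 : 0 < t := hy0.trans ht.1
    have hd := hasDerivAt_normSq_comp (hwt ht0) (ContinuousLinearMap.id ℝ Plane)
    rw [hd.deriv]
    have hder : deriv (f.rep + fun _ => -f.rep y) t = deriv f.rep t := by
      rw [Pi.add_def, deriv_add_const]
    simp only [ContinuousLinearMap.id_apply, hder, Pi.add_apply]
    have h1 := real_inner_le_norm (f.rep t + -f.rep y) (deriv f.rep t)
    have h2 : ‖f.rep t + -f.rep y‖ ≤ 2 * R := by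
      refine (norm_add_le _ _).trans ?_
      rw [norm_neg]
      linarith [hb t ht0, hb y hy0]
    have h3 := norm_deriv_le f.rep (hK t (hy.trans ht.1.le))
    have h4 : ‖tau P f.rep t‖ ≤ s⁻¹ + s * ‖tau P f.rep t‖ ^ 2 := by
      have : 0 ≤ s⁻¹ * ((1 - s * ‖tau P f.rep t‖) ^ 2 + s * ‖tau P f.rep t‖) := by positivity
      have e : s⁻¹ * ((1 - s * ‖tau P f.rep t‖) ^ 2 + s * ‖tau P f.rep t‖) =
          s⁻¹ - ‖tau P f.rep t‖ + s * ‖tau P f.rep t‖ ^ 2 := by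
        field_simp; ring
      linarith
    have h5 : ‖deriv f.rep t‖ ≤ ‖J‖ * (K * R + (s⁻¹ + s * ‖tau P f.rep t‖ ^ 2)) := by
      refine h3.trans ?_
      gcongr
      exact hb t ht0
    have h6 := mul_le_mul h2 h5 (norm_nonneg _) (by positivity)
    simp only [ψ]
    linarith

/-- Restriction of the representative to a compact interval away from the origin. -/
noncomputable def D0Graph.restrict {P : ℝ → Mat} {a b : ℝ} (ha : 0 < a) (f : D0Graph P) :
    BoundedContinuousFunction (Icc a b) Plane :=
  BoundedContinuousFunction.mkOfCompact
    ⟨(Icc a b).domRestrict f.rep, (f.locAC_rep.continuousOn.mono fun _ hx =>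
      ha.trans_le hx.1).domRestrict⟩

/-- Arzelà–Ascoli: the sup bound confines the values to a compact ball, and `D0Graph.exists_modulus`
gives a common modulus of continuity. -/
theorem D0Graph.totallyBounded_restrict {μm μp : ℝ} {P : ℝ → Mat} (hP : IsPotential μm μp P)
    {a b : ℝ} (ha : 0 < a) {r : ℝ} (hr : 0 ≤ r) :
    TotallyBounded (D0Graph.restrict (b := b) ha '' {f : D0Graph P | ‖f‖ ≤ r}) := by
  obtain ⟨C, hC0, hC⟩ := D0Graph.exists_norm_rep_le hP
  obtain ⟨D, hD0, hD⟩ := D0Graph.exists_modulus hP ha hr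
  refine (IsCompact.totallyBounded ?_).subset subset_closure
  refine BoundedContinuousFunction.arzela_ascoli (Metric.closedBall 0 (C * r))
    (isCompact_closedBall _ _) _ ?_ ?_
  · rintro _ x ⟨f, hf, rfl⟩
    rw [mem_closedBall_zero_iff]
    exact (hC f x (ha.trans_le x.2.1)).trans (mul_le_mul_of_nonneg_left hf hC0)
  · refine Metric.equicontinuous_of_continuity_modulus
      (fun t => √(D * (|t| + √|t|))) ?_ _ ?_
    · have : Continuous fun t : ℝ => √(D * (|t| + √|t|)) := by fun_prop
      simpa using this.tendsto 0
    · rintro x y ⟨_, f, hf, rfl⟩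
      rw [abs_of_nonneg dist_nonneg, dist_eq_norm]
      refine Real.le_sqrt_of_sq_le ?_
      exact hD f hf x y x.2.1 y.2.1

/-! ### Pointwise estimates for the nonlinear term -/

theorem app_sub (A B : Mat) (v : Plane) : app (A - B) v = app A v - app B v := by
  simp [app]

/-- Comparing with the value at 0 in (S2) then gives `‖S(x, z)‖ ≤ A |z|` on balls, uniformly in `x`.
-/
theorem ConditionS1.apply_zero {S : ℝ → Plane → Mat} {α : ℝ → ℝ} {η : Fin 2 → Fin 2 → Plane → ℝ}
    (hS1 : ConditionS1 S α η) {x : ℝ} (hx : 0 < x) : S x 0 = 0 := by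
  ext i j
  have h := hS1.bound x hx 0 i j
  rw [hS1.zero, mul_zero] at h
  exact abs_nonpos_iff.1 h

/-- Pointwise estimates for the nonlinear term on bounded sets. -/
theorem exists_lipschitz {S : ℝ → Plane → Mat} (hS0 : ∀ x > 0, S x 0 = 0) (hS2 : ConditionS2 S)
    {R : ℝ} (hR : 0 ≤ R) : ∃ A ≥ 0, ∀ x > 0, ∀ z w : Plane, ‖z‖ ≤ R → ‖w‖ ≤ R →
      ‖app (S x z) z‖ ≤ A * ‖z‖ ^ 2 ∧
      ‖app (S x z) z - app (S x w) w‖ ≤ 2 * A * R * ‖z - w‖ := by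
  obtain ⟨A, hA, h⟩ := hS2 (Metric.closedBall 0 R) (isCompact_closedBall _ _)
  have hb : ∀ x > 0, ∀ z : Plane, ‖z‖ ≤ R → ‖S x z‖ ≤ A * ‖z‖ := fun x hx z hz => by
    simpa [hS0 x hx] using h x hx z (by simpa using hz) 0 (by simpa using hR)
  refine ⟨A, hA.le, fun x hx z w hz hw => ⟨?_, ?_⟩⟩
  · calc _ ≤ ‖S x z‖ * ‖z‖ := norm_app_le _ _
      _ ≤ A * ‖z‖ * ‖z‖ := by gcongr; exact hb x hx z hz
      _ = _ := by ring
  · have e : app (S x z) z - app (S x w) w = app (S x z - S x w) z + app (S x w) (z - w) := by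
      rw [app_sub]; simp [app]
    rw [e]
    calc _ ≤ ‖S x z - S x w‖ * ‖z‖ + ‖S x w‖ * ‖z - w‖ :=
          norm_add_le_of_le (norm_app_le _ _) (norm_app_le _ _)
      _ ≤ A * ‖z - w‖ * R + A * R * ‖z - w‖ := by
          gcongr
          · exact h x hx z (by simpa using hz) w (by simpa using hw)
          · exact (hb x hx w hw).trans (by gcongr)
      _ = _ := by ring

theorem norm_app_le_of_entries {A : Mat} {m : ℝ} (hm : ∀ i j, |A i j| ≤ m) (v : Plane) :
    ‖app A v‖ ≤ 2 * m * ‖v‖ := by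
  have hm0 : 0 ≤ m := (abs_nonneg _).trans (hm 0 0)
  have hsq : ∀ i j, A i j ^ 2 ≤ m ^ 2 := fun i j =>
    sq_le_sq' (abs_le.1 (hm i j)).1 (abs_le.1 (hm i j)).2
  have key : ∀ i, (A i 0 * v 0 + A i 1 * v 1) ^ 2 ≤ 2 * m ^ 2 * (v 0 ^ 2 + v 1 ^ 2) := fun i => by
    calc _ ≤ (A i 0 ^ 2 + A i 1 ^ 2) * (v 0 ^ 2 + v 1 ^ 2) := by
          nlinarith [sq_nonneg (A i 0 * v 1 - A i 1 * v 0)]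
      _ ≤ _ := by gcongr; linarith [hsq i 0, hsq i 1]
  refine le_of_sq_le_sq ?_ (by positivity)
  rw [mul_pow, EuclideanSpace.real_norm_sq_eq, EuclideanSpace.real_norm_sq_eq]
  simp only [Fin.sum_univ_two, app, Matrix.toLpLin_apply, Matrix.mulVec, dotProduct]
  linarith [key 0, key 1]

/-- The nonlinear term is small at infinity on bounded sets. -/
theorem exists_tail {S : ℝ → Plane → Mat} {α : ℝ → ℝ} {η : Fin 2 → Fin 2 → Plane → ℝ}
    (hS1 : ConditionS1 S α η) (hα : Tendsto α atTop (𝓝 0)) (R : ℝ) {ε : ℝ} (hε : 0 < ε) :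
    ∃ b, ∀ x ≥ b, 0 < x → ∀ z : Plane, ‖z‖ ≤ R → ‖app (S x z) z‖ ≤ ε * ‖z‖ := by
  have h : ∀ i j, ∃ H ≥ 0, ∀ z : Plane, ‖z‖ ≤ R → |η i j z| ≤ H := fun i j => by
    obtain ⟨H, hH⟩ := (isCompact_closedBall (0 : Plane) R).exists_bound_of_continuousOn
      (hS1.continuous i j).continuousOn
    exact ⟨max H 0, le_max_right _ _, fun z hz => le_max_of_le_left (hH z (by simpa using hz))⟩
  choose H hH0 hH using h
  set T := ∑ i, ∑ j, H i j with hT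
  have hHT : ∀ i j, H i j ≤ T := fun i j =>
    (Finset.single_le_sum (f := fun j => H i j) (fun j _ => hH0 i j) (Finset.mem_univ j)).trans
      (Finset.single_le_sum (f := fun i => ∑ j, H i j)
        (fun i _ => Finset.sum_nonneg fun j _ => hH0 i j) (Finset.mem_univ i))
  have hlim : Tendsto (fun x => 2 * (|α x| * T)) atTop (𝓝 0) := by
    simpa using (hα.abs.mul_const T).const_mul 2
  obtain ⟨b, hb⟩ := eventually_atTop.1 (hlim.eventually_le_const hε)
  refine ⟨b, fun x hx hx0 z hz => ?_⟩
  refine (norm_app_le_of_entries (m := |α x| * T) (fun i j => ?_) z).trans ?_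
  · refine (hS1.bound x hx0 z i j).trans ((le_abs_self _).trans ?_)
    rw [abs_mul]
    gcongr
    exact (hH i j z hz).trans (hHT i j)
  · gcongr
    exact hb x hx

/-! ### The Nemytskii operator: continuity, order at zero, compactness -/

section Nemytskii

variable {μm μp : ℝ} {P : ℝ → Mat} {S : ℝ → Plane → Mat}

/-- One factor of the quadratic bound `A |z|²` is absorbed by the sup bound, leaving a multiple of
`|z| ∈ L²`. -/
theorem memLp_nemytskii (hP : IsPotential μm μp P)
    (hScont : ContinuousOn (fun p : ℝ × Plane => S p.1 p.2) (Ioi 0 ×ˢ univ))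
    (hS0 : ∀ x > 0, S x 0 = 0) (hS2 : ConditionS2 S) (f : D0Graph P) :
    MemLp (fun x => app (S x (f.rep x)) (f.rep x)) 2 halfLine := by
  obtain ⟨C, hC0, hC⟩ := D0Graph.exists_norm_rep_le hP
  obtain ⟨A, hA0, hA⟩ := exists_lipschitz hS0 hS2 (R := C * ‖f‖) (by positivity)
  have hz := f.locAC_rep.continuousOn
  refine f.memLp_rep.of_le_mul (c := A * (C * ‖f‖)) ?_ ?_
  · refine ContinuousOn.aestronglyMeasurable ?_ measurableSet_Ioi
    have h1 : ContinuousOn (fun x => S x (f.rep x)) (Ioi 0) :=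
      hScont.comp (continuousOn_id.prodMk hz) fun x hx => ⟨hx, mem_univ _⟩
    have h2 : Continuous fun B : Mat => toOp B :=
      LinearMap.continuous_of_finiteDimensional
        (Matrix.toEuclideanCLM (n := Fin 2) (𝕜 := ℝ)).toAlgEquiv.toLinearMap
    exact (h2.comp_continuousOn h1).clm_apply hz
  · refine (ae_restrict_iff' measurableSet_Ioi).2 (ae_of_all _ fun x hx => ?_)
    have hx0 : 0 < x := hx
    have hb := hC f x hx0
    calc _ ≤ A * ‖f.rep x‖ ^ 2 := (hA x hx0 _ _ hb hb).1
      _ = A * ‖f.rep x‖ * ‖f.rep x‖ := by ring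
      _ ≤ _ := by gcongr

variable {M : D0Graph P → L2}

theorem IsNemytskii.ae_eq_rep (hM : IsNemytskii S M) (f : D0Graph P) :
    M f =ᵐ[halfLine] fun x => app (S x (f.rep x)) (f.rep x) := by
  filter_upwards [hM f, f.toL2_ae_eq] with x h1 h2
  rw [h1, h2]

theorem IsNemytskii.sub_ae_eq (hM : IsNemytskii S M) (f g : D0Graph P) :
    (M f - M g : L2) =ᵐ[halfLine]
      fun x => app (S x (f.rep x)) (f.rep x) - app (S x (g.rep x)) (g.rep x) := by
  filter_upwards [Lp.coeFn_sub (M f) (M g), hM.ae_eq_rep f, hM.ae_eq_rep g] with x h1 h2 h3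
  rw [h1, Pi.sub_apply, h2, h3]

/-- The sup bound keeps all values in the ball of radius `C r`, where `z ↦ S(x, z) z` is Lipschitz
uniformly in `x`. -/
theorem IsNemytskii.exists_norm_sub_le (hP : IsPotential μm μp P) (hS0 : ∀ x > 0, S x 0 = 0)
    (hS2 : ConditionS2 S) (hM : IsNemytskii S M) {r : ℝ} (hr : 0 ≤ r) :
    ∃ L ≥ 0, ∀ f g : D0Graph P, ‖f‖ ≤ r → ‖g‖ ≤ r → ‖M f - M g‖ ≤ L * ‖f - g‖ := by
  obtain ⟨C, hC0, hC⟩ := D0Graph.exists_norm_rep_le hP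
  obtain ⟨A, hA0, hA⟩ := exists_lipschitz hS0 hS2 (R := C * r) (by positivity)
  refine ⟨2 * A * (C * r), by positivity, fun f g hf hg => ?_⟩
  have hfg : ‖M f - M g‖ ≤ 2 * A * (C * r) * ‖f.toL2 - g.toL2‖ := by
    refine Lp.norm_le_mul_norm_of_ae_le_mul ?_
    have hpos : ∀ᵐ x ∂halfLine, 0 < x := ae_restrict_mem measurableSet_Ioi
    filter_upwards [hM.sub_ae_eq f g, Lp.coeFn_sub f.toL2 g.toL2, f.toL2_ae_eq, g.toL2_ae_eq,
      hpos] with x h1 h2 h3 h4 hx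
    rw [h1, h2, Pi.sub_apply, h3, h4]
    exact (hA x hx _ _ ((hC f x hx).trans (by gcongr)) ((hC g x hx).trans (by gcongr))).2
  refine hfg.trans ?_
  gcongr
  rw [← map_sub]
  exact (f - g).norm_toL2_le

theorem IsNemytskii.continuous (hP : IsPotential μm μp P) (hS0 : ∀ x > 0, S x 0 = 0)
    (hS2 : ConditionS2 S) (hM : IsNemytskii S M) : Continuous M := by
  refine continuous_iff_continuousAt.2 fun f => ?_
  obtain ⟨L, -, hL⟩ := hM.exists_norm_sub_le hP hS0 hS2 (r := ‖f‖ + 1) (by positivity)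
  have h0 : Tendsto (fun g => L * ‖g - f‖) (𝓝 f) (𝓝 0) := by
    have : Continuous fun g => L * ‖g - f‖ := by fun_prop
    simpa using this.tendsto f
  refine tendsto_iff_norm_sub_tendsto_zero.2 (squeeze_zero' ?_ ?_ h0)
  · exact Eventually.of_forall fun _ => norm_nonneg _
  · filter_upwards [continuous_norm.continuousAt.eventually_le_const (lt_add_one ‖f‖)] with g hg
    exact hL g f hg (by linarith)

/-- In fact `‖M z‖ ≤ A C ‖z‖_0²` on the unit ball: one factor `|z|` is taken in sup norm, the other
in L². -/
theorem IsNemytskii.isLittleO (hP : IsPotential μm μp P) (hS0 : ∀ x > 0, S x 0 = 0)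
    (hS2 : ConditionS2 S) (hM : IsNemytskii S M) :
    M =o[𝓝 0] (fun z : D0Graph P => ‖z‖) := by
  obtain ⟨C, hC0, hC⟩ := D0Graph.exists_norm_rep_le hP
  obtain ⟨A, hA0, hA⟩ := exists_lipschitz hS0 hS2 (R := C) hC0
  have hb : ∀ f : D0Graph P, ‖f‖ ≤ 1 → ‖M f‖ ≤ A * C * ‖f‖ * ‖f‖ := fun f hf => by
    have h1 : ‖M f‖ ≤ A * C * ‖f‖ * ‖f.toL2‖ := by
      refine Lp.norm_le_mul_norm_of_ae_le_mul ?_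
      have hpos : ∀ᵐ x ∂halfLine, 0 < x := ae_restrict_mem measurableSet_Ioi
      filter_upwards [hM.ae_eq_rep f, f.toL2_ae_eq, hpos] with x h1 h2 hx
      rw [h1, h2]
      have hx1 := hC f x hx
      have hx2 : ‖f.rep x‖ ≤ C := hx1.trans (mul_le_of_le_one_right hC0 hf)
      calc _ ≤ A * ‖f.rep x‖ ^ 2 := (hA x hx _ _ hx2 hx2).1
        _ = A * ‖f.rep x‖ * ‖f.rep x‖ := by ring
        _ ≤ A * (C * ‖f‖) * ‖f.rep x‖ := by gcongr
        _ = _ := by ring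
    exact h1.trans (by gcongr; exact f.norm_toL2_le)
  refine Asymptotics.isLittleO_iff.2 fun c hc => ?_
  have h0 : Tendsto (fun f : D0Graph P => A * C * ‖f‖) (𝓝 0) (𝓝 0) := by
    have : Continuous fun f : D0Graph P => A * C * ‖f‖ := by fun_prop
    simpa using this.tendsto 0
  have h1 : Tendsto (fun f : D0Graph P => ‖f‖) (𝓝 0) (𝓝 0) := by
    simpa using (continuous_norm (E := D0Graph P)).tendsto 0
  filter_upwards [h0.eventually_le_const hc, h1.eventually_le_const one_pos] with f hf hf1
  rw [norm_norm]
  exact (hb f hf1).trans (by gcongr)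

theorem halfLine_real_Ioc {a : ℝ} (ha : 0 ≤ a) : halfLine.real (Ioc 0 a) = a := by
  rw [measureReal_restrict_apply measurableSet_Ioc,
    inter_eq_left.2 (show Ioc 0 a ⊆ Ioi 0 from fun x hx => hx.1)]
  simp [ha]

theorem integrable_indicator_Ioc (a c : ℝ) :
    Integrable ((Ioc 0 a).indicator fun _ => c) halfLine :=
  IntegrableOn.integrable_indicator (integrableOn_const (by
    rw [Measure.restrict_apply measurableSet_Ioc]
    exact ((measure_mono inter_subset_left).trans_lt measure_Ioc_lt_top).ne)) measurableSet_Ioc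

/-- On bounded sets, differences of the nonlinear term are controlled, up to a small error, by
uniform differences on a compact interval. -/
theorem IsNemytskii.exists_local_control (hP : IsPotential μm μp P) {α : ℝ → ℝ}
    {η : Fin 2 → Fin 2 → Plane → ℝ} (hS1 : ConditionS1 S α η) (hS2 : ConditionS2 S)
    (hα : Tendsto α atTop (𝓝 0)) (hM : IsNemytskii S M) {r : ℝ} (hr : 0 ≤ r) {ε : ℝ}
    (hε : 0 < ε) : ∃ a > 0, ∃ b, ∃ L ≥ 0, ∀ f g : D0Graph P, ‖f‖ ≤ r → ‖g‖ ≤ r → ∀ s : ℝ,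
      (∀ x ∈ Icc a b, ‖f.rep x - g.rep x‖ ≤ s) → ‖M f - M g‖ ^ 2 ≤ ε + L * s ^ 2 := by
  obtain ⟨C, hC0, hC⟩ := D0Graph.exists_norm_rep_le hP
  set R := C * r with hR
  have hR0 : 0 ≤ R := by positivity
  obtain ⟨A, hA0, hA⟩ := exists_lipschitz (fun x hx => hS1.apply_zero hx) hS2 hR0
  set Λ := 2 * A * R with hΛ
  have hΛ0 : 0 ≤ Λ := by positivity
  set D := (Λ * (2 * R)) ^ 2 with hD
  have hD0 : 0 ≤ D := by positivity
  -- Chosen so that the tail costs at most `4 e² (r² + 1) = ε / 2`; the other `ε / 2` goes to (0,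
  -- a], where `D` bounds the squared difference and `a D ≤ ε / 2`.
  set e := √(ε / (8 * (r ^ 2 + 1))) with he
  have he0 : 0 < e := Real.sqrt_pos.2 (by positivity)
  have he2 : e ^ 2 = ε / (8 * (r ^ 2 + 1)) := Real.sq_sqrt (by positivity)
  obtain ⟨b₀, hb₀⟩ := exists_tail hS1 hα R he0
  set a := ε / (2 * (D + 1)) with ha
  have ha0 : 0 < a := by positivity
  set b := max b₀ 0
  have hb0 : 0 ≤ b := le_max_right _ _
  refine ⟨a, ha0, b, Λ ^ 2 * b, by positivity, fun f g hf hg s hs => ?_⟩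
  have hbf : ∀ x > 0, ‖f.rep x‖ ≤ R := fun x hx => (hC f x hx).trans (by rw [hR]; gcongr)
  have hbg : ∀ x > 0, ‖g.rep x‖ ≤ R := fun x hx => (hC g x hx).trans (by rw [hR]; gcongr)
  -- A majorant whose three terms serve (0, a], (a, b] and (b, ∞) respectively. Overlaps do no harm
  -- since all terms are nonnegative, and no relation between `a` and `b` is needed.
  let G : ℝ → ℝ := fun x => (Ioc 0 a).indicator (fun _ => D) x +
    (Ioc 0 b).indicator (fun _ => Λ ^ 2 * s ^ 2) x +
    2 * e ^ 2 * (‖f.rep x‖ ^ 2 + ‖g.rep x‖ ^ 2)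
  have i1 := integrable_indicator_Ioc a D
  have i2 := integrable_indicator_Ioc b (Λ ^ 2 * s ^ 2)
  have i3 := integrable_normSq f.memLp_rep
  have i4 := integrable_normSq g.memLp_rep
  have i34 := (i3.add i4).const_mul (2 * e ^ 2)
  have hG : Integrable G halfLine := (i1.add i2).add i34
  have hle := L2_norm_sq_le (hM.sub_ae_eq f g) hG ?_
  · have hint : ∫ x, G x ∂halfLine =
        a * D + b * (Λ ^ 2 * s ^ 2) + 2 * e ^ 2 * (‖f.toL2‖ ^ 2 + ‖g.toL2‖ ^ 2) := by
      calc _ = (∫ x, (Ioc 0 a).indicator (fun _ => D) x ∂halfLine) +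
            (∫ x, (Ioc 0 b).indicator (fun _ => Λ ^ 2 * s ^ 2) x ∂halfLine) +
            ∫ x, 2 * e ^ 2 * (‖f.rep x‖ ^ 2 + ‖g.rep x‖ ^ 2) ∂halfLine := by
            rw [← integral_add i1 i2]
            exact integral_add (i1.add i2) i34
        _ = _ := by
            rw [integral_indicator_const _ measurableSet_Ioc,
              integral_indicator_const _ measurableSet_Ioc, halfLine_real_Ioc ha0.le,
              halfLine_real_Ioc hb0, integral_const_mul, integral_add i3 i4,
              ← f.norm_toL2_sq, ← g.norm_toL2_sq, smul_eq_mul, smul_eq_mul]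
    rw [hint] at hle
    have h1 : a * D ≤ ε / 2 := by
      rw [ha, div_mul_eq_mul_div, div_le_div_iff₀ (by positivity) two_pos]
      nlinarith
    have h2 : ‖f.toL2‖ ^ 2 ≤ r ^ 2 := by gcongr; exact f.norm_toL2_le.trans hf
    have h3 : ‖g.toL2‖ ^ 2 ≤ r ^ 2 := by gcongr; exact g.norm_toL2_le.trans hg
    have h4 : 2 * e ^ 2 * (‖f.toL2‖ ^ 2 + ‖g.toL2‖ ^ 2) ≤ ε / 2 := by
      calc _ ≤ 2 * e ^ 2 * (r ^ 2 + r ^ 2) := by gcongr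
        _ ≤ 4 * e ^ 2 * (r ^ 2 + 1) := by nlinarith
        _ = ε / 2 := by rw [he2]; field_simp; norm_num
    linarith
  · intro x hx
    have hN0 : 0 ≤ 2 * e ^ 2 * (‖f.rep x‖ ^ 2 + ‖g.rep x‖ ^ 2) := by positivity
    have hi1 : 0 ≤ (Ioc 0 a).indicator (fun _ => D) x := indicator_nonneg (fun _ _ => hD0) x
    have hi2 : 0 ≤ (Ioc 0 b).indicator (fun _ => Λ ^ 2 * s ^ 2) x :=
      indicator_nonneg (fun _ _ => by positivity) x
    have hlip := (hA x hx _ _ (hbf x hx) (hbg x hx)).2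
    simp only [G]
    rcases le_or_gt x a with hxa | hxa
    · rw [indicator_of_mem (show x ∈ Ioc 0 a from ⟨hx, hxa⟩)]
      have h1 : ‖f.rep x - g.rep x‖ ≤ 2 * R := by
        linarith [norm_sub_le (f.rep x) (g.rep x), hbf x hx, hbg x hx]
      have h2 : ‖app (S x (f.rep x)) (f.rep x) - app (S x (g.rep x)) (g.rep x)‖ ^ 2 ≤ D := by
        rw [hD]
        gcongr
        exact hlip.trans (by gcongr)
      linarith
    rcases le_or_gt x b with hxb | hxb
    · rw [indicator_of_mem (show x ∈ Ioc 0 b from ⟨hx, hxb⟩)]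
      have h2 : ‖app (S x (f.rep x)) (f.rep x) - app (S x (g.rep x)) (g.rep x)‖ ^ 2 ≤
          (Λ * s) ^ 2 := by
        gcongr
        exact hlip.trans (by gcongr; exact hs x ⟨hxa.le, hxb⟩)
      rw [mul_pow] at h2
      linarith
    · have hxb₀ : x ≥ b₀ := (le_max_left _ _).trans hxb.le
      have h1 : ‖app (S x (f.rep x)) (f.rep x) - app (S x (g.rep x)) (g.rep x)‖ ≤
          e * ‖f.rep x‖ + e * ‖g.rep x‖ :=
        norm_sub_le_of_le (hb₀ x hxb₀ hx _ (hbf x hx)) (hb₀ x hxb₀ hx _ (hbg x hx))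
      have h2 : ‖app (S x (f.rep x)) (f.rep x) - app (S x (g.rep x)) (g.rep x)‖ ^ 2 ≤
          (e * ‖f.rep x‖ + e * ‖g.rep x‖) ^ 2 := by gcongr
      nlinarith [sq_nonneg (e * ‖f.rep x‖ - e * ‖g.rep x‖)]

/-- A finite `s`-net for the restrictions to [a, b] in the sup norm is carried by `M` to a finite
`ε`-net in L². -/
theorem IsNemytskii.totallyBounded_image (hP : IsPotential μm μp P) {α : ℝ → ℝ}
    {η : Fin 2 → Fin 2 → Plane → ℝ} (hS1 : ConditionS1 S α η) (hS2 : ConditionS2 S)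
    (hα : Tendsto α atTop (𝓝 0)) (hM : IsNemytskii S M) {r : ℝ} (hr : 0 ≤ r) :
    TotallyBounded (M '' {f : D0Graph P | ‖f‖ ≤ r}) := by
  refine Metric.totallyBounded_iff.2 fun ε hε => ?_
  obtain ⟨a, ha, b, L, hL0, hL⟩ := hM.exists_local_control hP hS1 hS2 hα hr
    (show 0 < ε ^ 2 / 2 by positivity)
  set s := √(ε ^ 2 / (4 * (L + 1))) with hs
  have hs0 : 0 < s := Real.sqrt_pos.2 (by positivity)
  have hs2 : s ^ 2 = ε ^ 2 / (4 * (L + 1)) := Real.sq_sqrt (by positivity)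
  have hLs : L * s ^ 2 < ε ^ 2 / 2 := by
    rw [hs2, ← mul_div_assoc, div_lt_div_iff₀ (by positivity) two_pos]
    nlinarith [pow_pos hε 2]
  -- The net is taken among restrictions of elements of the ball itself, so that the control
  -- estimate applies to its points.
  obtain ⟨u, hur, huf, hcov⟩ := exists_subset_image_finite_and.1
    (Metric.finite_approx_of_totallyBounded
      (D0Graph.totallyBounded_restrict (b := b) hP ha hr) s hs0)
  refine ⟨M '' u, huf.image M, ?_⟩
  rintro _ ⟨f, hf, rfl⟩
  obtain ⟨_, ⟨g, hg, rfl⟩, hfg⟩ := mem_iUnion₂.1 (hcov (mem_image_of_mem _ hf))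
  refine mem_iUnion₂.2 ⟨M g, mem_image_of_mem _ hg, ?_⟩
  rw [mem_ball_iff_norm]
  refine lt_of_pow_lt_pow_left₀ 2 hε.le ?_
  refine (hL f g hf (hur hg) s fun x hx => ?_).trans_lt (by linarith)
  rw [← dist_eq_norm]
  exact ((f.restrict ha).dist_coe_le_dist (g := g.restrict ha) ⟨x, hx⟩).trans
    (Metric.mem_ball.1 hfg).le

end Nemytskii

end DiracHalfLine

theorem proposition4p1
    (μm μp : ℝ) (hμ : μm < μp)
    (P : ℝ → Mat) (hP : IsPotential μm μp P)
    (S : ℝ → Plane → Mat)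
    (hScont : ContinuousOn (fun p : ℝ × Plane => S p.1 p.2) (Set.Ioi 0 ×ˢ Set.univ))
    (hSsymm : ∀ x > 0, ∀ z, (S x z).IsSymm)
    (α : ℝ → ℝ) (η : Fin 2 → Fin 2 → Plane → ℝ)
    (hS1 : ConditionS1 S α η) (hS2 : ConditionS2 S)
    (hα : Filter.Tendsto α Filter.atTop (nhds 0)) :
    ∃ M : D0Graph P → L2, IsNemytskii S M ∧
      Continuous M ∧
      (∀ B : Set (D0Graph P), Bornology.IsBounded B → IsCompact (closure (M '' B))) ∧
      M =o[nhds 0] (fun z : D0Graph P => ‖z‖) := by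
  have hS0 : ∀ x > 0, S x 0 = 0 := fun x hx => hS1.apply_zero hx
  have hmem := memLp_nemytskii hP hScont hS0 hS2
  have hM : IsNemytskii S fun f : D0Graph P => (hmem f).toLp _ := fun f => by
    filter_upwards [(hmem f).coeFn_toLp, f.toL2_ae_eq] with x h1 h2
    rw [h1, h2]
  refine ⟨_, hM, hM.continuous hP hS0 hS2, fun B hB => ?_, hM.isLittleO hP hS0 hS2⟩
  obtain ⟨r, hr0, hr⟩ := hB.exists_pos_norm_le
  have ht := (hM.totallyBounded_image hP hS1 hS2 hα hr0.le).subset (image_mono hr)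
  exact ht.closure.isCompact_of_isClosed isClosed_closure
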